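/- Let $x_0>0$ and put $$\beta_1(x_0)=\frac{1}{x_0}\,\frac{3\pi}{\sqrt2}\,e^{3\pi/4}.$$ Let $0<\beta<\beta_1(x_0)$ and $u_0\in L^1(\mathbb{R})$ (real-valued), regarded as an element of $H^{-1}(\mathbb{R})=H^1(\mathbb{R})'$ through $\langle u_0,\varphi\rangle=\int_{\mathbb{R}}u_0\varphi\,dx$. Let $A:H^1(\mathbb{R})\to H^{-1}(\mathbb{R})$ be the operator induced by the Dirichlet form, $\langle Av,\varphi\rangle=\int_{\mathbb{R}}v'\varphi'\,dx$, and let $A_\beta v=Av+\beta\,v(x_0)\,\delta_0$ for $v\in H^1(\mathbb{R})$. Let $u$ be the solution of the linear Cauchy problem $$\dot u(t)+A_\beta u(t)=0\ \text{ in } H^{-1}(\mathbb{R})\text{ for } t>0,\qquad u(0)=u_0,$$ that is, of $u_t-u_{xx}=-\beta\,u(t,x_0)\,\delta_0$ on the real line, meaning that $u\in C([0,\infty);H^{-1}(\mathbb{R}))\cap C^1((0,\infty);H^{-1}(\mathbb{R}))\cap C((0,\infty);H^1(\mathbb{R}))$; for $t>0$ write $u(t,x)$ for the value at $x$ of the continuous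 representative of $u(t)\in H^1(\mathbb{R})$. Then $$u(t,x_0)=O\Bigl(\frac1t\Bigr)\quad\text{as }t\to\infty,$$ and, for every $x\in\mathbb{R}$ with $x\neq x_0$, $$u(t,x)=O\Bigl(\frac1{\sqrt t}\Bigr)\quad\text{as }t\to\infty.$$ -/

import Mathlib

open MeasureTheory Filter Topology Asymptotics

open scoped ContDiff

noncomputable section

namespace ThermostatLine

/-- The Lebesgue space `L²(ℝ)` of real-valued functions. -/
abbrev L2 : Type := Lp ℝ 2 (volume : Measure ℝ)

/-- `g` is the weak (distributional) derivative of `f` on the real line: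
`∫ f φ' = - ∫ g φ` for every test function `φ ∈ C_c^∞(ℝ)`. -/
def HasWeakDeriv (f g : ℝ → ℝ) : Prop :=
  ∀ φ : ℝ → ℝ, ContDiff ℝ ∞ φ → HasCompactSupport φ →
    ∫ x, f x * deriv φ x = - ∫ x, g x * φ x

/-! ### Auxiliary facts on weak derivatives -/

theorem integrable_mul_test {f φ : ℝ → ℝ} (hf : LocallyIntegrable f) (hφ : Continuous φ)
    (hs : HasCompactSupport φ) : Integrable (fun x => f x * φ x) := by
  have h := hf.integrable_smul_left_of_hasCompactSupport hφ hs
  refine h.congr (Eventually.of_forall fun x => ?_)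
  simp [mul_comm]

theorem HasWeakDeriv.add {f g f' g' : ℝ → ℝ} (hf : LocallyIntegrable f) (hg : LocallyIntegrable g)
    (hf' : LocallyIntegrable f') (hg' : LocallyIntegrable g')
    (h : HasWeakDeriv f g) (h' : HasWeakDeriv f' g') :
    HasWeakDeriv (fun x => f x + f' x) (fun x => g x + g' x) := by
  intro φ hφ hs
  have hd : Continuous (deriv φ) := hφ.continuous_deriv (by simp)
  simp only [add_mul]
  rw [integral_add (integrable_mul_test hf hd hs.deriv) (integrable_mul_test hf' hd hs.deriv),
    integral_add (integrable_mul_test hg hφ.continuous hs)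
      (integrable_mul_test hg' hφ.continuous hs), h φ hφ hs, h' φ hφ hs]
  ring

theorem HasWeakDeriv.const_mul {f g : ℝ → ℝ} (c : ℝ) (h : HasWeakDeriv f g) :
    HasWeakDeriv (fun x => c * f x) (fun x => c * g x) := by
  intro φ hφ hs
  simp only [mul_assoc, integral_const_mul, h φ hφ hs]
  ring

theorem HasWeakDeriv.congr {f g f' g' : ℝ → ℝ} (h : HasWeakDeriv f g) (hf : f =ᵐ[volume] f')
    (hg : g =ᵐ[volume] g') : HasWeakDeriv f' g' := by
  intro φ hφ hs
  have h1 : ∫ x, f' x * deriv φ x = ∫ x, f x * deriv φ x :=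
    integral_congr_ae (hf.mono fun x hx => by simp [hx])
  have h2 : ∫ x, g' x * φ x = ∫ x, g x * φ x :=
    integral_congr_ae (hg.mono fun x hx => by simp [hx])
  rw [h1, h2, h φ hφ hs]

/-- The primitive of a locally integrable function has that function as weak derivative. -/
theorem hasWeakDeriv_primitive {g : ℝ → ℝ} (hg : LocallyIntegrable g) :
    HasWeakDeriv (fun x => ∫ y in (0 : ℝ)..x, g y) g := by
  intro φ hφ hs
  have hgi : ∀ a b : ℝ, IntervalIntegrable g volume a b := fun a b => by
    rw [intervalIntegrable_iff]
    exact (hg.integrableOn_isCompact isCompact_uIcc).mono_set Set.uIoc_subset_uIcc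
  obtain ⟨R, hR⟩ := hs.isCompact.isBounded.subset_closedBall (0 : ℝ)
  set M : ℝ := |R| + 1 with hM
  have hM0 : 0 < M := by positivity
  have hout : ∀ x, x ∉ Set.Ioc (-M) M → x ∉ tsupport φ := by
    intro x hx hxs
    have := hR hxs
    rw [Metric.mem_closedBall, dist_zero_right, Real.norm_eq_abs] at this
    have h1 : |x| < M := lt_of_le_of_lt (this.trans (le_abs_self R)) (by simp [hM])
    exact hx ⟨(abs_lt.1 h1).1, (abs_lt.1 h1).2.le⟩
  have hφ0 : ∀ x, x ∉ tsupport φ → φ x = 0 := fun x hx => image_eq_zero_of_notMem_tsupport hx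
  have hdφ0 : ∀ x, x ∉ tsupport φ → deriv φ x = 0 := fun x hx =>
    image_eq_zero_of_notMem_tsupport fun h =>
      hx (closure_minimal support_deriv_subset (isClosed_tsupport φ) h)
  set G : ℝ → ℝ := fun x => ∫ y in (0 : ℝ)..x, g y with hG
  have hGac : AbsolutelyContinuousOnInterval G (-M) M :=
    (hgi (-M) M).absolutelyContinuousOnInterval_intervalIntegral (by
      rw [Set.uIcc_of_le (by linarith)]; constructor <;> linarith)
  have hφac : AbsolutelyContinuousOnInterval φ (-M) M :=
    ((hφ.of_le (by simp)).contDiffOn).absolutelyContinuousOnInterval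
  have key := hGac.integral_mul_deriv_eq_deriv_mul hφac
  have e1 : ∫ x, G x * deriv φ x = ∫ x in (-M)..M, G x * deriv φ x := by
    rw [intervalIntegral.integral_of_le (by linarith)]
    exact (setIntegral_eq_integral_of_forall_compl_eq_zero fun x hx => by
      simp [hdφ0 x (hout x hx)]).symm
  have e2 : ∫ x, g x * φ x = ∫ x in (-M)..M, g x * φ x := by
    rw [intervalIntegral.integral_of_le (by linarith)]
    exact (setIntegral_eq_integral_of_forall_compl_eq_zero fun x hx => by
      simp [hφ0 x (hout x hx)]).symm
  have e3 : ∫ x in (-M)..M, deriv G x * φ x = ∫ x in (-M)..M, g x * φ x := by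
    apply intervalIntegral.integral_congr_ae
    filter_upwards [(hgi (-M) M).ae_hasDerivAt_integral] with x hx hxm
    have := hx (Set.uIoc_subset_uIcc hxm) 0 (by
      rw [Set.uIcc_of_le (by linarith)]; constructor <;> linarith)
    rw [this.deriv]
  have b1 : φ (-M) = 0 := hφ0 _ (hout _ (by simp))
  have b2 : φ M = 0 := by
    apply hφ0
    intro hxs
    have := hR hxs
    rw [Metric.mem_closedBall, dist_zero_right, Real.norm_eq_abs, abs_of_pos hM0] at this
    have := le_abs_self R
    linarith
  rw [e1, e2, key, e3, b1, b2]
  ring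

/-- A locally integrable function with vanishing weak derivative is constant almost everywhere. -/
theorem HasWeakDeriv.ae_const {w : ℝ → ℝ} (hw : LocallyIntegrable w)
    (h : HasWeakDeriv w (fun _ => 0)) : ∃ c : ℝ, w =ᵐ[volume] fun _ => c := by
  obtain ⟨χ⟩ : Nonempty (ContDiffBump (0 : ℝ)) := inferInstance
  set η : ℝ → ℝ := χ.normed volume with hη
  have hηs : HasCompactSupport η := χ.hasCompactSupport_normed
  have hηc : ContDiff ℝ ∞ η := χ.contDiff_normed
  have hη1 : ∫ x, η x = 1 := χ.integral_normed
  refine ⟨∫ x, w x * η x, ?_⟩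
  apply ae_eq_of_integral_contDiff_smul_eq hw (locallyIntegrable_const _)
  intro ψ hψ hψs
  simp only [smul_eq_mul, integral_mul_const]
  set m : ℝ := ∫ x, ψ x with hm
  set ρ : ℝ → ℝ := fun x => ψ x - m * η x with hρ
  have hρc : ContDiff ℝ ∞ ρ := hψ.sub (contDiff_const.mul hηc)
  have hρs : HasCompactSupport ρ := by
    apply hψs.sub
    exact hηs.mul_left
  have hρi : Integrable ρ := hρc.continuous.integrable_of_hasCompactSupport hρs
  have hψi : Integrable ψ := hψ.continuous.integrable_of_hasCompactSupport hψs
  have hηi : Integrable η := hηc.continuous.integrable_of_hasCompactSupport hηs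
  have hρ0 : ∫ x, ρ x = 0 := by
    rw [hρ, integral_sub hψi (hηi.const_mul m), integral_const_mul, hη1]
    simp [hm]
  obtain ⟨R, hR⟩ := hρs.isCompact.isBounded.subset_closedBall (0 : ℝ)
  have hρz : ∀ x, |R| < |x| → ρ x = 0 := by
    intro x hx
    apply image_eq_zero_of_notMem_tsupport
    intro hxs
    have := hR hxs
    rw [Metric.mem_closedBall, dist_zero_right, Real.norm_eq_abs] at this
    have := le_abs_self R
    linarith
  set a : ℝ := -(|R| + 1) with ha
  set Φ : ℝ → ℝ := fun x => ∫ y in a..x, ρ y with hΦ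
  have hΦd : ∀ x, HasDerivAt Φ (ρ x) x := fun x =>
    intervalIntegral.integral_hasDerivAt_right (hρc.continuous.intervalIntegrable _ _)
      hρc.continuous.stronglyMeasurable.stronglyMeasurableAtFilter hρc.continuous.continuousAt
  have hΦderiv : deriv Φ = ρ := funext fun x => (hΦd x).deriv
  have hΦc : ContDiff ℝ ∞ Φ := by
    rw [contDiff_infty_iff_deriv, hΦderiv]
    exact ⟨fun x => (hΦd x).differentiableAt, hρc⟩
  have hΦs : HasCompactSupport Φ := by
    apply HasCompactSupport.intro (isCompact_Icc (a := a) (b := |R| + 1))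
    intro x hx
    rw [Set.mem_Icc, not_and_or, not_le, not_le] at hx
    rcases hx with hx | hx
    · apply intervalIntegral.integral_zero_ae
      refine Eventually.of_forall fun y hy => hρz y ?_
      rw [Set.uIoc_of_ge hx.le] at hy
      have : y < 0 := by have := hy.2; have := abs_nonneg R; rw [ha] at *; linarith
      rw [abs_of_neg this]
      have := hy.2
      rw [ha] at this
      linarith
    · have h0 : a ≤ x := by have := abs_nonneg R; rw [ha]; linarith
      rw [hΦ]
      simp only
      rw [intervalIntegral.integral_of_le h0,
        setIntegral_eq_integral_of_forall_compl_eq_zero, hρ0]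
      intro y hy
      apply hρz
      rw [Set.mem_Ioc, not_and_or, not_lt, not_le] at hy
      have := abs_nonneg R
      rcases hy with hy | hy
      · rw [ha] at hy
        linarith [neg_le_abs y]
      · linarith [le_abs_self y]
  have h1 := h Φ hΦc hΦs
  rw [hΦderiv] at h1
  simp only [zero_mul, integral_zero, neg_zero] at h1
  have h2 : ∫ x, w x * ρ x = (∫ x, ψ x * w x) - m * ∫ x, w x * η x := by
    rw [← integral_const_mul, ← integral_sub]
    · refine integral_congr_ae (Eventually.of_forall fun x => ?_)
      simp only [hρ]
      ring
    · refine (integrable_mul_test hw hψ.continuous hψs).congr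
        (Eventually.of_forall fun x => ?_)
      simp [mul_comm]
    · exact (integrable_mul_test hw hηc.continuous hηs).const_mul m
  linarith

theorem locallyIntegrable_L2 (f : L2) : LocallyIntegrable (f : ℝ → ℝ) :=
  (Lp.memLp f).locallyIntegrable (by norm_num)

/-! ### The Sobolev space `H¹(ℝ)` -/

/-- The Sobolev space `H¹(ℝ)`: pairs `(f, f')` in `L²(ℝ) × L²(ℝ)` whose second entry is the weak
derivative of the first (so that the second entry is determined by the first), with the norm
`‖f‖²_{H¹} = ‖f‖²_{L²} + ‖f'‖²_{L²}` inherited from the Hilbert space `L²(ℝ) × L²(ℝ)`. -/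
def H1 : Submodule ℝ (WithLp 2 (L2 × L2)) where
  carrier := {p | HasWeakDeriv p.fst p.snd}
  zero_mem' := by
    intro φ _ _
    have h0 : ((0 : L2) : ℝ → ℝ) =ᵐ[volume] fun _ => (0 : ℝ) := Lp.coeFn_zero _ _ _
    have h1 : ∫ x, ((0 : L2) : ℝ → ℝ) x * deriv φ x = 0 := by
      rw [integral_congr_ae (h0.mono fun x hx => by rw [hx, zero_mul]), integral_zero]
    have h2 : ∫ x, ((0 : L2) : ℝ → ℝ) x * φ x = 0 := by
      rw [integral_congr_ae (h0.mono fun x hx => by rw [hx, zero_mul]), integral_zero]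
    change ∫ x, ((0 : L2) : ℝ → ℝ) x * deriv φ x = - ∫ x, ((0 : L2) : ℝ → ℝ) x * φ x
    rw [h1, h2, neg_zero]
  add_mem' := by
    intro p q hp hq
    exact (HasWeakDeriv.add (locallyIntegrable_L2 _) (locallyIntegrable_L2 _)
      (locallyIntegrable_L2 _) (locallyIntegrable_L2 _) hp hq).congr
      (Lp.coeFn_add p.fst q.fst).symm (Lp.coeFn_add p.snd q.snd).symm
  smul_mem' := by
    intro c p hp
    exact (HasWeakDeriv.const_mul c hp).congr
      (Lp.coeFn_smul c p.fst).symm (Lp.coeFn_smul c p.snd).symm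

namespace H1

/-- The inclusion `H¹(ℝ) → L²(ℝ)`. -/
def toL2 : H1 →L[ℝ] L2 := (WithLp.fstL 2 ℝ L2 L2).comp H1.subtypeL

/-- The weak derivative `H¹(ℝ) → L²(ℝ)`. -/
def weakDeriv : H1 →L[ℝ] L2 := (WithLp.sndL 2 ℝ L2 L2).comp H1.subtypeL

theorem hasWeakDeriv (v : H1) : HasWeakDeriv (toL2 v) (weakDeriv v) := v.2

theorem norm_sq_eq (v : H1) : ‖v‖ ^ 2 = ‖toL2 v‖ ^ 2 + ‖weakDeriv v‖ ^ 2 :=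
  WithLp.prod_norm_sq_eq_of_L2 (v : WithLp 2 (L2 × L2))

/-- Every element of `H¹(ℝ)` has a continuous representative, the primitive of its weak
derivative. -/
theorem exists_continuous_rep (v : H1) :
    ∃ w : ℝ → ℝ, Continuous w ∧ (toL2 v : ℝ → ℝ) =ᵐ[volume] w ∧
      ∀ a b : ℝ, w b - w a = ∫ y in a..b, weakDeriv v y := by
  set g : ℝ → ℝ := ⇑(weakDeriv v) with hgdef
  have hg : LocallyIntegrable g := locallyIntegrable_L2 _
  have hf : LocallyIntegrable (toL2 v : ℝ → ℝ) := locallyIntegrable_L2 _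
  have hgi : ∀ a b : ℝ, IntervalIntegrable g volume a b := fun a b => by
    rw [intervalIntegrable_iff]
    exact (hg.integrableOn_isCompact isCompact_uIcc).mono_set Set.uIoc_subset_uIcc
  have hGc : Continuous fun x => ∫ y in (0 : ℝ)..x, g y :=
    intervalIntegral.continuous_primitive hgi 0
  have hg' : LocallyIntegrable fun x => -1 * g x := hg.smul (-1 : ℝ)
  have h0 := (hasWeakDeriv v).add hf hg (hGc.const_mul (-1)).locallyIntegrable
    hg' ((hasWeakDeriv_primitive hg).const_mul (-1))
  have h1 := h0.congr (f' := fun x => (toL2 v : ℝ → ℝ) x + -1 * ∫ y in (0 : ℝ)..x, g y)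
    (g' := fun _ => 0) (by rfl) (Eventually.of_forall fun x => by simp [hgdef])
  obtain ⟨c, hc⟩ := h1.ae_const (hf.add (hGc.const_mul (-1)).locallyIntegrable)
  refine ⟨fun x => c + ∫ y in (0 : ℝ)..x, g y, continuous_const.add hGc, ?_, ?_⟩
  · filter_upwards [hc] with x hx
    rw [Pi.add_apply] at hx
    linarith
  · intro a b
    rw [← intervalIntegral.integral_interval_sub_left (hgi 0 b) (hgi 0 a)]
    ring

/-- The continuous representative of an element of `H¹(ℝ)` (it is unique). -/
def rep (v : H1) : ℝ → ℝ := (exists_continuous_rep v).choose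

theorem continuous_rep (v : H1) : Continuous (rep v) := (exists_continuous_rep v).choose_spec.1

theorem rep_ae_eq (v : H1) : (toL2 v : ℝ → ℝ) =ᵐ[volume] rep v :=
  (exists_continuous_rep v).choose_spec.2.1

theorem rep_sub_rep (v : H1) (a b : ℝ) : rep v b - rep v a = ∫ y in a..b, weakDeriv v y :=
  (exists_continuous_rep v).choose_spec.2.2 a b

theorem rep_unique (v : H1) {w : ℝ → ℝ} (hw : Continuous w)
    (h : (toL2 v : ℝ → ℝ) =ᵐ[volume] w) : rep v = w :=
  (Continuous.ae_eq_iff_eq volume (continuous_rep v) hw).1 ((rep_ae_eq v).symm.trans h)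

theorem rep_add (v w : H1) : rep (v + w) = fun x => rep v x + rep w x := by
  apply rep_unique _ ((continuous_rep v).add (continuous_rep w))
  rw [map_add]
  filter_upwards [Lp.coeFn_add (toL2 v) (toL2 w), rep_ae_eq v, rep_ae_eq w] with x h1 h2 h3
  simp only [h1, Pi.add_apply, h2, h3]

theorem rep_smul (c : ℝ) (v : H1) : rep (c • v) = fun x => c * rep v x := by
  apply rep_unique _ ((continuous_rep v).const_mul c)
  rw [map_smul]
  filter_upwards [Lp.coeFn_smul c (toL2 v), rep_ae_eq v] with x h1 h2
  rw [h1, Pi.smul_apply, h2, smul_eq_mul]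

/-- By Cauchy-Schwarz, the integral over an interval of length one is bounded by the norm. -/
theorem integral_abs_le (f : L2) (x : ℝ) : ∫ y in Set.Icc x (x + 1), |(f : ℝ → ℝ) y| ≤ ‖f‖ := by
  have : IsProbabilityMeasure (volume.restrict (Set.Icc x (x + 1))) := ⟨by simp⟩
  have hf : AEStronglyMeasurable (f : ℝ → ℝ) (volume.restrict (Set.Icc x (x + 1))) :=
    (Lp.aestronglyMeasurable f).restrict
  have h1 : eLpNorm (f : ℝ → ℝ) 1 (volume.restrict (Set.Icc x (x + 1))) ≤
      eLpNorm (f : ℝ → ℝ) 2 volume :=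
    (eLpNorm_le_eLpNorm_of_exponent_le (by norm_num) hf).trans
      (eLpNorm_mono_measure _ Measure.restrict_le_self)
  have h2 : ∫ y in Set.Icc x (x + 1), |(f : ℝ → ℝ) y| =
      (eLpNorm (f : ℝ → ℝ) 1 (volume.restrict (Set.Icc x (x + 1)))).toReal := by
    rw [eLpNorm_one_eq_lintegral_enorm, ← integral_norm_eq_lintegral_enorm hf]
    rfl
  rw [h2, Lp.norm_def]
  exact ENNReal.toReal_mono (Lp.eLpNorm_ne_top f) h1

/-- The Sobolev embedding `H¹(ℝ) ↪ BUC(ℝ)`. -/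
theorem abs_rep_le (v : H1) (x : ℝ) : |rep v x| ≤ 2 * ‖v‖ := by
  have hI : ∀ f : L2, IntegrableOn (fun y => |(f : ℝ → ℝ) y|) (Set.Icc x (x + 1)) := fun f =>
    ((locallyIntegrable_L2 f).integrableOn_isCompact isCompact_Icc).abs
  have key : ∀ y ∈ Set.Icc x (x + 1), |rep v x| ≤ |rep v y| + ‖weakDeriv v‖ := by
    intro y hy
    have h1 := rep_sub_rep v x y
    have h2 : |∫ z in x..y, (weakDeriv v : ℝ → ℝ) z| ≤ ‖weakDeriv v‖ := by
      refine le_trans ?_ (integral_abs_le (weakDeriv v) x)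
      rw [intervalIntegral.integral_of_le hy.1]
      refine (abs_integral_le_integral_abs).trans ?_
      exact setIntegral_mono_set (hI _) (Eventually.of_forall fun _ => abs_nonneg _)
        (Set.Ioc_subset_Icc_self.trans (Set.Icc_subset_Icc le_rfl hy.2)).eventuallyLE
    have h3 : rep v x = rep v y - ∫ z in x..y, (weakDeriv v : ℝ → ℝ) z := by linarith
    rw [h3]
    exact (abs_sub _ _).trans (by linarith)
  have hrep : ∫ y in Set.Icc x (x + 1), |rep v y| ≤ ‖toL2 v‖ := by
    refine le_trans (le_of_eq ?_) (integral_abs_le (toL2 v) x)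
    apply integral_congr_ae
    filter_upwards [ae_restrict_of_ae (rep_ae_eq v)] with y hy
    rw [hy]
  have hci : IntegrableOn (fun y => |rep v y|) (Set.Icc x (x + 1)) :=
    (continuous_rep v).abs.continuousOn.integrableOn_compact isCompact_Icc
  have hvol : volume.real (Set.Icc x (x + 1)) = 1 := by simp
  have h4 : |rep v x| ≤ ‖toL2 v‖ + ‖weakDeriv v‖ := by
    have h5 : ∫ _ in Set.Icc x (x + 1), |rep v x| ≤
        ∫ y in Set.Icc x (x + 1), (|rep v y| + ‖weakDeriv v‖) :=
      setIntegral_mono_on (integrableOn_const (by simp)) (hci.add (integrableOn_const (by simp)))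
        measurableSet_Icc key
    rw [integral_add hci (integrableOn_const (by simp))] at h5
    simp only [setIntegral_const, hvol, one_smul] at h5
    linarith
  have h6 : ‖toL2 v‖ ≤ ‖v‖ := by
    apply le_of_sq_le_sq _ (norm_nonneg v)
    rw [norm_sq_eq]
    linarith [sq_nonneg ‖weakDeriv v‖]
  have h7 : ‖weakDeriv v‖ ≤ ‖v‖ := by
    apply le_of_sq_le_sq _ (norm_nonneg v)
    rw [norm_sq_eq]
    linarith [sq_nonneg ‖toL2 v‖]
  linarith

end H1

/-! ### The dual space `H⁻¹(ℝ)` and the operators of the problem -/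

/-- `H⁻¹(ℝ)`, the dual space of `H¹(ℝ)`, with the dual norm. -/
abbrev HNeg1 : Type := StrongDual ℝ H1

/-- The Dirac functional `δ_x : v ↦ v(x)` (the value of the continuous representative), an element
of `H⁻¹(ℝ)`; as a map on `H¹(ℝ)` it is also the evaluation (trace) at `x`. -/
def dirac (x : ℝ) : HNeg1 :=
  LinearMap.mkContinuous
    { toFun := fun v => H1.rep v x
      map_add' := fun v w => by rw [H1.rep_add]
      map_smul' := fun c v => by rw [H1.rep_smul]; rfl }
    2 (fun v => H1.abs_rep_le v x)

@[simp]
theorem dirac_apply (x : ℝ) (v : H1) : dirac x v = H1.rep v x := rfl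

/-- The embedding `L¹(ℝ) ↪ H⁻¹(ℝ)`, `⟨f, φ⟩ = ∫ f φ`. -/
def ofL1 (f : ℝ → ℝ) (hf : Integrable f) : HNeg1 :=
  have hint : ∀ v : H1, Integrable fun x => f x * H1.rep v x := fun v =>
    hf.mul_bdd (c := 2 * ‖v‖) (H1.continuous_rep v).aestronglyMeasurable
      (Eventually.of_forall fun x => H1.abs_rep_le v x)
  LinearMap.mkContinuous
    { toFun := fun v => ∫ x, f x * H1.rep v x
      map_add' := fun v w => by
        rw [H1.rep_add, ← integral_add (hint v) (hint w)]
        simp only [mul_add]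
      map_smul' := fun c v => by
        rw [H1.rep_smul, RingHom.id_apply, smul_eq_mul, ← integral_const_mul]
        congr 1
        funext x
        ring }
    ((∫ x, |f x|) * 2) (fun v => by
      rw [mul_assoc, ← integral_mul_const]
      refine (abs_integral_le_integral_abs).trans
        (integral_mono (hint v).abs (hf.abs.mul_const _) fun x => ?_)
      simp only [abs_mul]
      exact mul_le_mul_of_nonneg_left (H1.abs_rep_le v x) (abs_nonneg _))

@[simp]
theorem ofL1_apply (f : ℝ → ℝ) (hf : Integrable f) (v : H1) :
    ofL1 f hf v = ∫ x, f x * H1.rep v x := rfl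

/-- The embedding `H¹(ℝ) ↪ H⁻¹(ℝ)` through the `L²` pairing, `⟨v, φ⟩ = ∫ v φ`. -/
def embed : H1 →L[ℝ] HNeg1 := (innerSL ℝ : L2 →L[ℝ] L2 →L[ℝ] ℝ).bilinearComp H1.toL2 H1.toL2

theorem embed_apply (v φ : H1) : embed v φ = ∫ x, H1.rep v x * H1.rep φ x := by
  change inner ℝ (H1.toL2 v) (H1.toL2 φ) = _
  rw [L2.inner_def]
  apply integral_congr_ae
  filter_upwards [H1.rep_ae_eq v, H1.rep_ae_eq φ] with x h1 h2
  simp [h1, h2, mul_comm]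

/-- The operator `A = -∂ₓₓ : H¹(ℝ) → H⁻¹(ℝ)` induced by the Dirichlet form,
`⟨A v, φ⟩ = ∫ v' φ'`. -/
def opA : H1 →L[ℝ] HNeg1 :=
  (innerSL ℝ : L2 →L[ℝ] L2 →L[ℝ] ℝ).bilinearComp H1.weakDeriv H1.weakDeriv

theorem opA_apply (v φ : H1) : opA v φ = ∫ x, H1.weakDeriv v x * H1.weakDeriv φ x := by
  change inner ℝ (H1.weakDeriv v) (H1.weakDeriv φ) = _
  rw [L2.inner_def]
  simp [mul_comm]

/-- The operator `A_β = A + β δ₀ δ_{x₀}ᵀ : H¹(ℝ) → H⁻¹(ℝ)`, i.e. `A_β v = A v + β v(x₀) δ₀`. -/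
def opAβ (β x₀ : ℝ) : H1 →L[ℝ] HNeg1 := opA + β • (dirac x₀).smulRight (dirac 0)

theorem opAβ_apply (β x₀ : ℝ) (v : H1) :
    opAβ β x₀ v = opA v + (β * H1.rep v x₀) • dirac 0 := by
  simp [opAβ, smul_smul]

/-- `u` is a (classical) solution in `H⁻¹(ℝ)` of the linear Cauchy problem
`u' + A_β u = 0` for `t > 0`, `u(0) = U₀ ∈ H⁻¹(ℝ)`, that is, of
`u_t - u_xx = -β u(t, x₀) δ₀` on the real line: `u` takes values in the domain `H¹(ℝ)` of `A_β` for
`t > 0`, it belongs to `C¹((0,∞); H⁻¹) ∩ C((0,∞); H¹)`, satisfies the equation in `H⁻¹(ℝ)` for every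
`t > 0`, and `u(t) → U₀` in `H⁻¹(ℝ)` as `t → 0+`.
Only the values `u t` with `t > 0` matter. -/
structure IsSolution (β x₀ : ℝ) (U₀ : HNeg1) (u : ℝ → H1) : Prop where
  continuousOn : ContinuousOn u (Set.Ioi 0)
  hasDerivAt : ∀ t : ℝ, 0 < t → HasDerivAt (fun τ => embed (u τ)) (-(opAβ β x₀ (u t))) t
  initial : Tendsto (fun t => embed (u t)) (𝓝[>] 0) (𝓝 U₀)

/-- The critical value `β₁(x₀) = c / x₀`, `c = (3π/√2) e^{3π/4}`. -/
def betaOne (x₀ : ℝ) : ℝ := 3 * Real.pi / √2 * Real.exp (3 * Real.pi / 4) / x₀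

end ThermostatLine

end

noncomputable section

namespace ThermostatLine

/-! ### Exponential kernels as elements of `H¹(ℝ)` -/

/-! For Re z > 0 the kernel k = e^{-|ξ - a| z} satisfies A k = 2z δ_a - z² k (`opA_kernH1`). Pairing
a solution with it (`lap`) turns the equation into an ODE in t, forced by the two values u(t, a) and
u(t, x₀). Combining the pairings at a = x and a = x₀ with the weight `mult` eliminates u(t, x₀): the
combination r = `resPair` satisfies r' = z² r - 2z u(t, x), so e^{z²(T - t)} r(t) has t-derivative
-2z e^{z²(T - t)} u(t, x).

Integrate this over a ray arg z = θ with π/4 < θ < π/2, where Re z > 0 and Re z² < 0. Since ∫ 2z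
e^{z²τ} dz = -1/τ is real, the imaginary part of the ray integral (`evolve`) does not depend on t ∈
(0, T). As t → 0 it tends to the same expression for u₀. As t → T it tends to π u(T, x): the pairing
at x alone produces the heat kernel, while the part carrying `mult` drops out, because its ray can
be rotated to the positive axis, where `charFn` is real. The resulting formula `pi_mul_rep_eq` is
derived for an arbitrary solution, without semigroups or a uniqueness theorem.

Decay is read off the formula. With u₀ ∈ L¹ the factor `resPair` is bounded on the ray, and the
Gaussian e^{-bTρ²} integrates to a multiple of T^{-1/2}. At x = x₀ one has 1 - `mult` = 2z /
`charFn`, and the additional factor ρ improves this to T^{-1}.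

The bound on β enters only through the zeros of D(z) = 2z + β e^{-x₀ z}: below `betaOne x₀` there
are none in a sector reaching beyond arg z = π/4, so an admissible ray exists. -/

theorem integrable_exp_neg_abs {b : ℝ} (hb : 0 < b) (a : ℝ) :
    Integrable fun ξ : ℝ => Real.exp (-(|ξ - a| * b)) := by
  have h : Integrable fun ξ : ℝ => Real.exp (-(|ξ| * b)) := by
    rw [← integrableOn_univ, ← Set.Iic_union_Ioi (a := (0 : ℝ))]
    refine IntegrableOn.union ?_ ?_
    · refine (integrableOn_exp_mul_Iic hb 0).congr_fun (fun x hx => ?_) measurableSet_Iic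
      simp only
      rw [abs_of_nonpos hx]
      ring_nf
    · refine (integrableOn_exp_mul_Ioi (a := -b) (by linarith) 0).congr_fun (fun x hx => ?_)
        measurableSet_Ioi
      simp only
      rw [abs_of_pos hx]
      ring_nf
  exact h.comp_sub_right a

theorem integral_exp_neg_abs {b : ℝ} (hb : 0 < b) (a : ℝ) :
    ∫ ξ : ℝ, Real.exp (-(|ξ - a| * b)) = 2 / b := by
  rw [integral_sub_right_eq_self (fun ξ : ℝ => Real.exp (-(|ξ| * b))) a,
    integral_comp_abs (f := fun r => Real.exp (-(r * b)))]
  have h := integral_exp_mul_Ioi (a := -b) (by linarith) 0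
  have e : (fun r : ℝ => Real.exp (-(r * b))) = fun r => Real.exp (-b * r) := by
    funext r; ring_nf
  rw [e, h]
  simp
  field_simp

/-- The complex kernel `e^{-|ξ - a| z}`. -/
def kern (a : ℝ) (z : ℂ) (ξ : ℝ) : ℂ := Complex.exp (-((|ξ - a| : ℝ) * z))

theorem norm_kern (a : ℝ) (z : ℂ) (ξ : ℝ) : ‖kern a z ξ‖ = Real.exp (-(|ξ - a| * z.re)) := by
  simp [kern, Complex.norm_exp]

theorem continuous_kern (a : ℝ) (z : ℂ) : Continuous (kern a z) := by
  unfold kern; fun_prop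

theorem norm_kern_le_one (a : ℝ) {z : ℂ} (hz : 0 ≤ z.re) (ξ : ℝ) : ‖kern a z ξ‖ ≤ 1 := by
  rw [norm_kern]
  apply Real.exp_le_one_iff.2
  have := mul_nonneg (abs_nonneg (ξ - a)) hz
  linarith

theorem tendsto_norm_kern {z : ℂ} (hz : 0 < z.re) (a : ℝ) {x : ℕ → ℝ}
    (hx : ∀ n : ℕ, |x n - a| = n) : Tendsto (fun n => kern a z (x n)) atTop (𝓝 0) := by
  rw [tendsto_zero_iff_norm_tendsto_zero]
  simp only [norm_kern, hx]
  apply Real.tendsto_exp_neg_atTop_nhds_zero.comp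
  exact (tendsto_natCast_atTop_atTop (R := ℝ)).atTop_mul_const hz

theorem memLp_two_of_le_exp {f : ℝ → ℝ} (hf : AEStronglyMeasurable f volume) {a b C : ℝ}
    (hb : 0 < b) (h : ∀ ξ, |f ξ| ≤ C * Real.exp (-(|ξ - a| * b))) : MemLp f 2 volume := by
  rw [memLp_two_iff_integrable_sq hf]
  refine ((integrable_exp_neg_abs (b := 2 * b) (by linarith) a).const_mul (C ^ 2)).mono'
    (hf.pow 2) (Eventually.of_forall fun ξ => ?_)
  rw [Real.norm_eq_abs, abs_pow]
  calc |f ξ| ^ 2 ≤ (C * Real.exp (-(|ξ - a| * b))) ^ 2 :=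
        pow_le_pow_left₀ (abs_nonneg _) (h ξ) 2
    _ = C ^ 2 * Real.exp (-(|ξ - a| * (2 * b))) := by
        rw [mul_pow, ← Real.exp_nat_mul]; congr 2; push_cast; ring

/-- The square of the exponential has integral 1/b. With b = Re z this is the origin of every factor
ρ^{-1/2} in the estimates along a ray. -/
theorem norm_toLp_le_of_le_exp {f : ℝ → ℝ} (hf : MemLp f 2 volume) {a b C : ℝ}
    (hb : 0 < b) (hC : 0 ≤ C) (h : ∀ ξ, |f ξ| ≤ C * Real.exp (-(|ξ - a| * b))) :
    ‖hf.toLp f‖ ≤ C / √b := by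
  have h2 : ‖hf.toLp f‖ ^ 2 = ∫ ξ, f ξ ^ 2 := by
    rw [← real_inner_self_eq_norm_sq, L2.inner_def]
    apply integral_congr_ae
    filter_upwards [hf.coeFn_toLp] with x hx
    rw [hx]
    simp [sq]
  have h3 : ∫ ξ, f ξ ^ 2 ≤ ∫ ξ, C ^ 2 * Real.exp (-(|ξ - a| * (2 * b))) := by
    apply integral_mono hf.integrable_sq
      ((integrable_exp_neg_abs (b := 2 * b) (by linarith) a).const_mul _)
    intro ξ
    calc f ξ ^ 2 = |f ξ| ^ 2 := (sq_abs _).symm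
      _ ≤ (C * Real.exp (-(|ξ - a| * b))) ^ 2 :=
          pow_le_pow_left₀ (abs_nonneg _) (h ξ) 2
      _ = C ^ 2 * Real.exp (-(|ξ - a| * (2 * b))) := by
          rw [mul_pow, ← Real.exp_nat_mul]; congr 2; push_cast; ring
  rw [integral_const_mul, integral_exp_neg_abs (by linarith)] at h3
  apply le_of_sq_le_sq _ (by positivity)
  rw [h2, div_pow, Real.sq_sqrt hb.le]
  refine h3.trans (le_of_eq ?_)
  field_simp

/-- The real kernel `Re (c e^{-|ξ - a| z})`. -/
def reKern (a : ℝ) (z c : ℂ) (ξ : ℝ) : ℝ := (c * kern a z ξ).re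

theorem continuous_reKern (a : ℝ) (z c : ℂ) : Continuous (reKern a z c) :=
  Complex.continuous_re.comp (continuous_const.mul (continuous_kern a z))

theorem abs_reKern_le (a : ℝ) (z c : ℂ) (ξ : ℝ) :
    |reKern a z c ξ| ≤ ‖c‖ * Real.exp (-(|ξ - a| * z.re)) := by
  rw [← norm_kern, ← norm_mul]
  exact Complex.abs_re_le_norm _

/-- The derivative of `Re (c e^{-|ξ - a| z})` away from `a`. -/
def reKernDeriv (a : ℝ) (z c : ℂ) (ξ : ℝ) : ℝ :=
  if ξ ≤ a then reKern a z (z * c) ξ else -reKern a z (z * c) ξ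

theorem reKern_eq_of_le {a ξ : ℝ} (z c : ℂ) (h : ξ ≤ a) :
    reKern a z c ξ = (c * Complex.exp ((ξ - a : ℝ) * z)).re := by
  unfold reKern kern
  rw [abs_of_nonpos (by linarith)]
  congr 3
  push_cast; ring

theorem reKern_eq_of_ge {a ξ : ℝ} (z c : ℂ) (h : a ≤ ξ) :
    reKern a z c ξ = (c * Complex.exp ((ξ - a : ℝ) * -z)).re := by
  unfold reKern kern
  rw [abs_of_nonneg (by linarith)]
  congr 3
  push_cast; ring

theorem hasDerivAt_re_exp (a : ℝ) (z c : ℂ) (ξ : ℝ) :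
    HasDerivAt (fun ξ : ℝ => (c * Complex.exp ((ξ - a : ℝ) * z)).re)
      ((z * c * Complex.exp ((ξ - a : ℝ) * z)).re) ξ := by
  have h1 : HasDerivAt (fun ξ : ℝ => ((ξ - a : ℝ) : ℂ)) 1 ξ := by
    simpa using (((hasDerivAt_id ξ).sub_const a).ofReal_comp)
  have h2 := ((h1.mul_const z).cexp.const_mul c)
  have h3 := Complex.reCLM.hasFDerivAt.comp_hasDerivAt ξ h2
  refine h3.congr_deriv ?_
  change (c * (Complex.exp ((ξ - a : ℝ) * z) * (1 * z))).re = _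
  congr 1
  ring

theorem abs_reKernDeriv_le (a : ℝ) (z c : ℂ) (ξ : ℝ) :
    |reKernDeriv a z c ξ| ≤ ‖z * c‖ * Real.exp (-(|ξ - a| * z.re)) := by
  unfold reKernDeriv
  split_ifs
  · exact abs_reKern_le _ _ _ _
  · rw [abs_neg]; exact abs_reKern_le _ _ _ _

theorem measurable_reKernDeriv (a : ℝ) (z c : ℂ) : Measurable (reKernDeriv a z c) :=
  Measurable.ite measurableSet_Iic (continuous_reKern _ _ _).measurable
    (continuous_reKern _ _ _).measurable.neg

theorem hasDerivAt_reKern {a ξ : ℝ} (z c : ℂ) (h : ξ ≠ a) :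
    HasDerivAt (reKern a z c) (reKernDeriv a z c ξ) ξ := by
  rcases lt_or_gt_of_ne h with h | h
  · have := hasDerivAt_re_exp a z c ξ
    rw [← reKern_eq_of_le z (z * c) h.le] at this
    rw [reKernDeriv, if_pos h.le]
    refine this.congr_of_eventuallyEq ?_
    filter_upwards [Iio_mem_nhds h] with y hy using reKern_eq_of_le z c (le_of_lt hy)
  · have := hasDerivAt_re_exp a (-z) c ξ
    have e : ((-z) * c * Complex.exp ((ξ - a : ℝ) * -z)).re = -reKern a z (z * c) ξ := by
      rw [reKern_eq_of_ge z (z * c) h.le, ← Complex.neg_re]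
      congr 1; ring
    rw [e] at this
    rw [reKernDeriv, if_neg (not_le.2 h)]
    refine this.congr_of_eventuallyEq ?_
    filter_upwards [Ioi_mem_nhds h] with y hy using reKern_eq_of_ge z c (le_of_lt hy)

theorem memLp_reKern (a : ℝ) {z : ℂ} (hz : 0 < z.re) (c : ℂ) : MemLp (reKern a z c) 2 volume :=
  memLp_two_of_le_exp (continuous_reKern a z c).aestronglyMeasurable hz (abs_reKern_le a z c)

theorem memLp_reKernDeriv (a : ℝ) {z : ℂ} (hz : 0 < z.re) (c : ℂ) :
    MemLp (reKernDeriv a z c) 2 volume :=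
  memLp_two_of_le_exp (measurable_reKernDeriv a z c).aestronglyMeasurable hz
    (abs_reKernDeriv_le a z c)

/-- The kernel is continuous at its kink, so the kink contributes no Dirac mass to the first
derivative: the fundamental theorem of calculus on [-n, n] tolerates the one exceptional point a. -/
theorem hasWeakDeriv_reKern (a : ℝ) {z : ℂ} (hz : 0 < z.re) (c : ℂ) :
    HasWeakDeriv (reKern a z c) (reKernDeriv a z c) := by
  intro φ hφ hs
  have hd : Continuous (deriv φ) := hφ.continuous_deriv (by simp)
  have i1 := integrable_mul_test ((memLp_reKern a hz c).locallyIntegrable (by norm_num)) hd hs.deriv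
  have i2 := integrable_mul_test ((memLp_reKernDeriv a hz c).locallyIntegrable (by norm_num))
    hφ.continuous hs
  have key : ∀ n : ℕ, ∫ x in (-(n : ℝ))..n,
      (reKernDeriv a z c x * φ x + reKern a z c x * deriv φ x) =
      reKern a z c n * φ n - reKern a z c (-n) * φ (-n) := by
    intro n
    apply integral_eq_of_hasDerivAt_off_countable (fun x => reKern a z c x * φ x) _
      (Set.countable_singleton a)
      ((continuous_reKern a z c).mul hφ.continuous).continuousOn
    · intro x hx
      exact (hasDerivAt_reKern z c hx.2).mul
        ((hφ.differentiable (by simp)).differentiableAt.hasDerivAt)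
    · exact (i2.add i1).intervalIntegrable
  have l1 := intervalIntegral_tendsto_integral (l := atTop) (i2.add i1)
    (tendsto_neg_atTop_atBot.comp (tendsto_natCast_atTop_atTop (R := ℝ)))
    (tendsto_natCast_atTop_atTop (R := ℝ))
  have l2 : Tendsto (fun n : ℕ => reKern a z c n * φ n - reKern a z c (-n) * φ (-n)) atTop
      (𝓝 0) := by
    obtain ⟨R, hR⟩ := hs.isCompact.isBounded.subset_closedBall (0 : ℝ)
    have h0 : ∀ x : ℝ, R < |x| → φ x = 0 := fun x hx =>
      image_eq_zero_of_notMem_tsupport fun hxs => by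
        have := hR hxs
        rw [Metric.mem_closedBall, dist_zero_right, Real.norm_eq_abs] at this
        linarith
    refine tendsto_const_nhds.congr' ?_
    filter_upwards [(tendsto_natCast_atTop_atTop (R := ℝ)).eventually_gt_atTop R] with n hn
    have hn' : R < |(n : ℝ)| := by simpa using hn
    rw [h0 n hn', h0 (-n) (by simpa using hn)]
    simp
  have l3 : ∫ x, (reKernDeriv a z c x * φ x + reKern a z c x * deriv φ x) = 0 :=
    tendsto_nhds_unique (l1.congr key) l2
  rw [integral_add i2 i1] at l3
  linarith

/-- The kernel `Re (c e^{-|ξ - a| z})` as an element of `H¹(ℝ)`. -/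
def kernH1 (a : ℝ) (z : ℂ) (hz : 0 < z.re) (c : ℂ) : H1 :=
  ⟨WithLp.toLp 2 ((memLp_reKern a hz c).toLp _, (memLp_reKernDeriv a hz c).toLp _),
    (hasWeakDeriv_reKern a hz c).congr (memLp_reKern a hz c).coeFn_toLp.symm
      (memLp_reKernDeriv a hz c).coeFn_toLp.symm⟩

theorem weakDeriv_kernH1 (a : ℝ) (z : ℂ) (hz : 0 < z.re) (c : ℂ) :
    H1.weakDeriv (kernH1 a z hz c) = (memLp_reKernDeriv a hz c).toLp _ := rfl

theorem rep_kernH1 (a : ℝ) (z : ℂ) (hz : 0 < z.re) (c : ℂ) :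
    H1.rep (kernH1 a z hz c) = reKern a z c :=
  H1.rep_unique _ (continuous_reKern a z c) (memLp_reKern a hz c).coeFn_toLp

theorem norm_toL2_kernH1_le (a : ℝ) (z : ℂ) (hz : 0 < z.re) (c : ℂ) :
    ‖H1.toL2 (kernH1 a z hz c)‖ ≤ ‖c‖ / √z.re :=
  norm_toLp_le_of_le_exp (memLp_reKern a hz c) hz (norm_nonneg _) (abs_reKern_le a z c)

theorem norm_kernH1_le (a : ℝ) (z : ℂ) (hz : 0 < z.re) (c : ℂ) :
    ‖kernH1 a z hz c‖ ≤ ‖c‖ * (1 + ‖z‖) / √z.re := by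
  have h1 := norm_toL2_kernH1_le a z hz c
  have h2 : ‖H1.weakDeriv (kernH1 a z hz c)‖ ≤ ‖z * c‖ / √z.re :=
    norm_toLp_le_of_le_exp (memLp_reKernDeriv a hz c) hz (norm_nonneg _)
      (abs_reKernDeriv_le a z c)
  rw [norm_mul] at h2
  have h3 : ‖kernH1 a z hz c‖ ≤
      ‖H1.toL2 (kernH1 a z hz c)‖ + ‖H1.weakDeriv (kernH1 a z hz c)‖ := by
    apply le_of_sq_le_sq _ (by positivity)
    rw [H1.norm_sq_eq]
    nlinarith [norm_nonneg (H1.toL2 (kernH1 a z hz c)),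
      norm_nonneg (H1.weakDeriv (kernH1 a z hz c))]
  calc _ ≤ _ := h3
    _ ≤ ‖c‖ / √z.re + ‖z‖ * ‖c‖ / √z.re := add_le_add h1 h2
    _ = _ := by ring

/-! ### The Dirichlet form against exponential kernels -/

/-- Integration by parts of an element of `H¹(ℝ)` against a `C¹` function. -/
theorem H1.intervalIntegral_weakDeriv_mul (v : H1) {F F' : ℝ → ℝ} (hF : ∀ x, HasDerivAt F (F' x) x)
    (hF' : Continuous F') (a b : ℝ) :
    ∫ x in a..b, H1.weakDeriv v x * F x =
      H1.rep v b * F b - H1.rep v a * F a - ∫ x in a..b, H1.rep v x * F' x := by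
  have hgi : ∀ a b : ℝ, IntervalIntegrable (H1.weakDeriv v : ℝ → ℝ) volume a b := fun a b => by
    rw [intervalIntegrable_iff]
    exact ((locallyIntegrable_L2 _).integrableOn_isCompact isCompact_uIcc).mono_set
      Set.uIoc_subset_uIcc
  have hrep : H1.rep v = fun x => H1.rep v a + ∫ y in a..x, H1.weakDeriv v y := by
    funext x; rw [← H1.rep_sub_rep]; ring
  have hc1 : ContDiff ℝ 1 F := by
    rw [contDiff_one_iff_deriv]
    refine ⟨fun x => (hF x).differentiableAt, ?_⟩
    rwa [show deriv F = F' from funext fun x => (hF x).deriv]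
  have hFac : AbsolutelyContinuousOnInterval F a b :=
    hc1.contDiffOn.absolutelyContinuousOnInterval
  -- The representative is a primitive of a locally integrable function, hence absolutely
  -- continuous; this is all that integration by parts requires.
  have hvac : AbsolutelyContinuousOnInterval (H1.rep v) a b := by
    rw [hrep]
    exact AbsolutelyContinuousOnInterval.add
      ((LipschitzWith.const' (K := 0) (H1.rep v a)).lipschitzOnWith.absolutelyContinuousOnInterval)
      ((hgi a b).absolutelyContinuousOnInterval_intervalIntegral Set.left_mem_uIcc)
  have key := hvac.integral_mul_deriv_eq_deriv_mul hFac
  have e1 : ∫ x in a..b, deriv (H1.rep v) x * F x = ∫ x in a..b, H1.weakDeriv v x * F x := by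
    apply intervalIntegral.integral_congr_ae
    filter_upwards [(hgi a b).ae_hasDerivAt_integral] with x hx hxm
    have h1 := hx (Set.uIoc_subset_uIcc hxm) a Set.left_mem_uIcc
    have h2 : HasDerivAt (H1.rep v) (H1.weakDeriv v x) x := by
      rw [hrep]; exact h1.const_add _
    rw [h2.deriv]
  rw [show deriv F = F' from funext fun x => (hF x).deriv, e1] at key
  linarith

theorem H1.integrable_rep_mul_rep (v w : H1) :
    Integrable fun ξ => H1.rep v ξ * H1.rep w ξ := by
  have h := L2.integrable_inner (𝕜 := ℝ) (H1.toL2 v) (H1.toL2 w)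
  refine h.congr ?_
  filter_upwards [H1.rep_ae_eq v, H1.rep_ae_eq w] with x h1 h2
  simp [h1, h2, mul_comm]

/-- Weak form of -k'' = 2z δ_a - z² k. Each side of a is integrated by parts separately: the jump of
k' at a yields the point value of v, and the outer boundary terms vanish because v is bounded and k
decays. -/
theorem opA_kernH1 (v : H1) (a : ℝ) (z : ℂ) (hz : 0 < z.re) (c : ℂ) :
    opA v (kernH1 a z hz c) =
      2 * (z * c).re * H1.rep v a - embed v (kernH1 a z hz (z * (z * c))) := by
  have hw : Integrable fun x => H1.weakDeriv v x * reKernDeriv a z c x := by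
    have h := L2.integrable_inner (𝕜 := ℝ) (H1.weakDeriv v) (H1.weakDeriv (kernH1 a z hz c))
    refine h.congr ?_
    rw [weakDeriv_kernH1]
    filter_upwards [(memLp_reKernDeriv a hz c).coeFn_toLp] with x h1
    simp [h1, mul_comm]
  have hv : Integrable fun x => H1.rep v x * reKern a z (z * (z * c)) x := by
    have := H1.integrable_rep_mul_rep v (kernH1 a z hz (z * (z * c)))
    rwa [rep_kernH1] at this
  have eA : opA v (kernH1 a z hz c) = ∫ x, H1.weakDeriv v x * reKernDeriv a z c x := by
    rw [opA_apply, weakDeriv_kernH1]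
    apply integral_congr_ae
    filter_upwards [(memLp_reKernDeriv a hz c).coeFn_toLp] with x h1
    rw [h1]
  have hself : ∀ d : ℂ, reKern a z d a = d.re := by intro d; simp [reKern, kern]
  have key : ∀ n : ℕ, ∫ x in (a - n)..(a + n), H1.weakDeriv v x * reKernDeriv a z c x =
      -(H1.rep v (a + n) * reKern a z (z * c) (a + n)) -
        H1.rep v (a - n) * reKern a z (z * c) (a - n) + 2 * (z * c).re * H1.rep v a -
      ∫ x in (a - n)..(a + n), H1.rep v x * reKern a z (z * (z * c)) x := by
    intro n
    have hn : (0 : ℝ) ≤ n := Nat.cast_nonneg n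
    rw [← intervalIntegral.integral_add_adjacent_intervals (b := a) hw.intervalIntegrable
      hw.intervalIntegrable, ← intervalIntegral.integral_add_adjacent_intervals (b := a)
      hv.intervalIntegrable hv.intervalIntegrable]
    have hl := H1.intervalIntegral_weakDeriv_mul v (hasDerivAt_re_exp a z (z * c))
      (by fun_prop) (a - n) a
    -- To the right of a the derivative of the kernel is again an exponential, with z replaced by -z
    -- and amplitude -(z c).
    have hr := H1.intervalIntegral_weakDeriv_mul v (hasDerivAt_re_exp a (-z) (-(z * c)))
      (by fun_prop) a (a + n)
    have l1 : ∫ x in (a - n)..a, H1.weakDeriv v x * reKernDeriv a z c x =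
        ∫ x in (a - n)..a, H1.weakDeriv v x * (z * c * Complex.exp ((x - a : ℝ) * z)).re := by
      apply intervalIntegral.integral_congr_ae
      refine Eventually.of_forall fun x hx => ?_
      rw [Set.uIoc_of_le (by linarith)] at hx
      rw [reKernDeriv, if_pos hx.2, reKern_eq_of_le _ _ hx.2]
    have l2 : ∫ x in (a - n)..a, H1.rep v x * reKern a z (z * (z * c)) x =
        ∫ x in (a - n)..a, H1.rep v x * (z * (z * c) * Complex.exp ((x - a : ℝ) * z)).re := by
      apply intervalIntegral.integral_congr_ae
      refine Eventually.of_forall fun x hx => ?_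
      rw [Set.uIoc_of_le (by linarith)] at hx
      rw [reKern_eq_of_le _ _ hx.2]
    have r1 : ∫ x in a..(a + n), H1.weakDeriv v x * reKernDeriv a z c x =
        ∫ x in a..(a + n),
          H1.weakDeriv v x * (-(z * c) * Complex.exp ((x - a : ℝ) * -z)).re := by
      apply intervalIntegral.integral_congr_ae
      refine Eventually.of_forall fun x hx => ?_
      rw [Set.uIoc_of_le (by linarith)] at hx
      rw [reKernDeriv, if_neg (not_le.2 hx.1), reKern_eq_of_ge _ _ hx.1.le, neg_mul,
        Complex.neg_re]
    have r2 : ∫ x in a..(a + n), H1.rep v x * reKern a z (z * (z * c)) x =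
        ∫ x in a..(a + n),
          H1.rep v x * (-z * -(z * c) * Complex.exp ((x - a : ℝ) * -z)).re := by
      apply intervalIntegral.integral_congr_ae
      refine Eventually.of_forall fun x hx => ?_
      rw [Set.uIoc_of_le (by linarith)] at hx
      rw [reKern_eq_of_ge _ _ hx.1.le, neg_mul_neg]
    rw [l1, l2, r1, r2, hl, hr, reKern_eq_of_le _ _ (by linarith : a - n ≤ a),
      reKern_eq_of_ge _ _ (by linarith : a ≤ a + n)]
    simp only [sub_self, Complex.ofReal_zero, zero_mul, Complex.exp_zero, mul_one, neg_mul,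
      Complex.neg_re]
    ring
  have lw := intervalIntegral_tendsto_integral (l := atTop) (a := fun n : ℕ => a - n)
    (b := fun n : ℕ => a + n) hw
    (tendsto_atBot_add_const_left _ a
      (tendsto_neg_atTop_atBot.comp (tendsto_natCast_atTop_atTop (R := ℝ))))
    (tendsto_atTop_add_const_left _ a (tendsto_natCast_atTop_atTop (R := ℝ)))
  have lv := intervalIntegral_tendsto_integral (l := atTop) (a := fun n : ℕ => a - n)
    (b := fun n : ℕ => a + n) hv
    (tendsto_atBot_add_const_left _ a
      (tendsto_neg_atTop_atBot.comp (tendsto_natCast_atTop_atTop (R := ℝ))))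
    (tendsto_atTop_add_const_left _ a (tendsto_natCast_atTop_atTop (R := ℝ)))
  have lb : ∀ y : ℕ → ℝ, (∀ n : ℕ, |y n - a| = n) →
      Tendsto (fun n => H1.rep v (y n) * reKern a z (z * c) (y n)) atTop (𝓝 0) := by
    intro y hy
    have h0 : Tendsto (fun n => reKern a z (z * c) (y n)) atTop (𝓝 0) := by
      have := (Complex.continuous_re.tendsto _).comp
        ((tendsto_norm_kern hz a hy).const_mul (z * c))
      simp only [mul_zero, Complex.zero_re] at this
      exact this
    refine squeeze_zero_norm (a := fun n => 2 * ‖v‖ * ‖reKern a z (z * c) (y n)‖) (fun n => ?_) ?_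
    · rw [norm_mul]
      exact mul_le_mul_of_nonneg_right (H1.abs_rep_le v _) (norm_nonneg _)
    · simpa using h0.norm.const_mul (2 * ‖v‖)
  have hp := lb (fun n => a + n) (by simp)
  have hm := lb (fun n => a - n) (by simp)
  have lim := tendsto_nhds_unique (lw.congr key)
    (((hp.neg.sub hm).add_const (2 * (z * c).re * H1.rep v a)).sub lv)
  rw [eA, lim, embed_apply, rep_kernH1]
  simp

/-! ### Integrals along rays and rotation of the contour -/

/-- The unit complex number of argument `θ`. -/
def dir (θ : ℝ) : ℂ := Complex.exp (θ * Complex.I)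

theorem norm_dir (θ : ℝ) : ‖dir θ‖ = 1 := Complex.norm_exp_ofReal_mul_I θ

theorem dir_re (θ : ℝ) : (dir θ).re = Real.cos θ := Complex.exp_ofReal_mul_I_re θ

theorem dir_im (θ : ℝ) : (dir θ).im = Real.sin θ := Complex.exp_ofReal_mul_I_im θ

theorem dir_ne_zero (θ : ℝ) : dir θ ≠ 0 := Complex.exp_ne_zero _

theorem dir_zero : dir 0 = 1 := by simp [dir]

theorem dir_pi_div_two : dir (Real.pi / 2) = Complex.I := by
  simp [dir, Complex.exp_pi_div_two_mul_I]

theorem continuous_dir : Continuous dir := by unfold dir; fun_prop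

theorem re_mul_dir (ρ θ : ℝ) : ((ρ : ℂ) * dir θ).re = ρ * Real.cos θ := by
  rw [Complex.re_ofReal_mul, dir_re]

theorem re_sq_mul_dir (ρ θ : ℝ) :
    (((ρ : ℂ) * dir θ) ^ 2).re = ρ ^ 2 * Real.cos (2 * θ) := by
  rw [mul_pow, ← Complex.ofReal_pow, Complex.re_ofReal_mul, dir, ← Complex.exp_nat_mul,
    ← Complex.exp_ofReal_mul_I_re]
  congr 3
  push_cast; ring

theorem norm_mul_dir {ρ : ℝ} (hρ : 0 ≤ ρ) (θ : ℝ) : ‖(ρ : ℂ) * dir θ‖ = ρ := by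
  rw [norm_mul, norm_dir, mul_one, Complex.norm_real, Real.norm_of_nonneg hρ]

/-- The integral of `F` along the ray of argument `θ`. -/
def rayInt (θ : ℝ) (F : ℂ → ℂ) : ℂ := ∫ ρ in Set.Ioi (0 : ℝ), F (ρ * dir θ) * dir θ

theorem exp_image_univ : Real.exp '' Set.univ = Set.Ioi 0 := by
  rw [Set.image_univ, Real.range_exp]

/-- Rotation of a ray of integration, by Cauchy's theorem in a sector. -/
theorem rayInt_eq_rayInt {F : ℂ → ℂ} {α γ : ℝ} (hαγ : α ≤ γ)
    (hF : ∀ ρ : ℝ, 0 < ρ → ∀ φ ∈ Set.Icc α γ, DifferentiableAt ℂ F (ρ * dir φ))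
    (hα : IntegrableOn (fun ρ : ℝ => F (ρ * dir α)) (Set.Ioi 0))
    (hγ : IntegrableOn (fun ρ : ℝ => F (ρ * dir γ)) (Set.Ioi 0))
    {g : ℝ → ℝ} (hg : ∀ ρ : ℝ, 0 < ρ → ∀ φ ∈ Set.Icc α γ, ‖F (ρ * dir φ)‖ ≤ g ρ)
    (h0 : Tendsto (fun ρ => ρ * g ρ) (𝓝[>] 0) (𝓝 0))
    (h1 : Tendsto (fun ρ => ρ * g ρ) atTop (𝓝 0)) : rayInt α F = rayInt γ F := by
  -- The substitution z = e^ζ maps the strip α ≤ Im ζ ≤ γ onto the sector, so Cauchy's theorem is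
  -- needed only on the rectangles [-n, n] × [α, γ]. The vertical sides become arcs of radius
  -- e^{±n}, controlled by ρ g(ρ).
  set G : ℂ → ℂ := fun ζ => F (Complex.exp ζ) * Complex.exp ζ with hG
  have hexp : ∀ x φ : ℝ, Complex.exp (x + φ * Complex.I) = (Real.exp x : ℝ) * dir φ := by
    intro x φ; rw [Complex.exp_add, Complex.ofReal_exp, dir]
  have hGx : ∀ x φ : ℝ, G (x + φ * Complex.I) =
      |Real.exp x| • (F ((Real.exp x : ℝ) * dir φ) * dir φ) := by
    intro x φ
    simp only [hG]
    rw [hexp, abs_of_pos (Real.exp_pos x), Complex.real_smul]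
    ring
  have hder : ∀ x ∈ (Set.univ : Set ℝ), HasDerivWithinAt Real.exp (Real.exp x) Set.univ x :=
    fun x _ => (Real.hasDerivAt_exp x).hasDerivWithinAt
  have hinj : Set.InjOn Real.exp Set.univ := Real.exp_injective.injOn
  have hor : ∀ φ : ℝ, IntegrableOn (fun ρ : ℝ => F (ρ * dir φ)) (Set.Ioi 0) →
      Tendsto (fun n : ℕ => ∫ x : ℝ in (-(n : ℝ))..n, G (x + φ * Complex.I)) atTop
        (𝓝 (rayInt φ F)) := by
    intro φ hφ
    have i1 : IntegrableOn (fun ρ : ℝ => F (ρ * dir φ) * dir φ) (Real.exp '' Set.univ) := by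
      rw [exp_image_univ]; exact hφ.mul_const _
    rw [integrableOn_image_iff_integrableOn_abs_deriv_smul MeasurableSet.univ hder hinj] at i1
    have i2 : Integrable fun x : ℝ => G (x + φ * Complex.I) := by
      simp only [hGx]; rwa [integrableOn_univ] at i1
    have l := intervalIntegral_tendsto_integral (l := atTop) i2
      (tendsto_neg_atTop_atBot.comp (tendsto_natCast_atTop_atTop (R := ℝ)))
      (tendsto_natCast_atTop_atTop (R := ℝ))
    have e : ∫ x : ℝ, G (x + φ * Complex.I) = rayInt φ F := by
      rw [rayInt, ← exp_image_univ,
        integral_image_eq_integral_abs_deriv_smul MeasurableSet.univ hder hinj,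
        setIntegral_univ]
      simp only [hGx]
    rw [e] at l
    exact l
  have hver : ∀ y : ℕ → ℝ, Tendsto (fun n => Real.exp (y n) * g (Real.exp (y n))) atTop (𝓝 0) →
      Tendsto (fun n : ℕ => Complex.I • ∫ φ : ℝ in α..γ, G (y n + φ * Complex.I)) atTop
        (𝓝 0) := by
    intro y hy
    refine squeeze_zero_norm
      (a := fun n => Real.exp (y n) * g (Real.exp (y n)) * |γ - α|) (fun n => ?_) ?_
    · rw [norm_smul, Complex.norm_I, one_mul]
      apply intervalIntegral.norm_integral_le_of_norm_le_const
      intro φ hφ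
      rw [Set.uIoc_of_le hαγ] at hφ
      rw [hGx, norm_smul, norm_mul, norm_dir, mul_one, abs_of_pos (Real.exp_pos _),
        Real.norm_of_nonneg (Real.exp_pos _).le]
      exact mul_le_mul_of_nonneg_left (hg _ (Real.exp_pos _) φ ⟨hφ.1.le, hφ.2⟩)
        (Real.exp_pos _).le
    · simpa using hy.mul_const |γ - α|
  have htop := hver (fun n => n)
    (h1.comp (Real.tendsto_exp_atTop.comp (tendsto_natCast_atTop_atTop (R := ℝ))))
  have hbot := hver (fun n => -(n : ℝ))
    (h0.comp ((Real.tendsto_exp_atBot_nhdsGT).comp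
      (tendsto_neg_atTop_atBot.comp (tendsto_natCast_atTop_atTop (R := ℝ)))))
  have key : ∀ n : ℕ, (∫ x : ℝ in (-(n : ℝ))..n, G (x + α * Complex.I)) -
      (∫ x : ℝ in (-(n : ℝ))..n, G (x + γ * Complex.I)) +
      Complex.I • (∫ φ : ℝ in α..γ, G (((n : ℝ) : ℂ) + φ * Complex.I)) -
      Complex.I • (∫ φ : ℝ in α..γ, G (((-(n : ℝ) : ℝ) : ℂ) + φ * Complex.I)) = 0 := by
    intro n
    have h := Complex.integral_boundary_rect_eq_zero_of_differentiableOn G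
      ⟨-(n : ℝ), α⟩ ⟨(n : ℝ), γ⟩ ?_
    · simpa using h
    · intro ζ hζ
      have him : ζ.im ∈ Set.Icc α γ := by
        have := hζ.2
        rwa [Set.mem_preimage, Set.uIcc_of_le hαγ] at this
      have h2 := hF (Real.exp ζ.re) (Real.exp_pos _) ζ.im him
      rw [← hexp, Complex.re_add_im] at h2
      exact (DifferentiableAt.mul (h2.comp ζ Complex.differentiableAt_exp)
        Complex.differentiableAt_exp).differentiableWithinAt
  have lim := tendsto_nhds_unique (tendsto_const_nhds.congr fun n => (key n).symm)
    ((((hor α hα).sub (hor γ hγ)).add htop).sub hbot)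
  simp only [add_zero, sub_zero] at lim
  exact (sub_eq_zero.1 lim.symm)

/-- Integrability of a Gaussian along half a line. -/
theorem integrableOn_exp_neg_sq {b : ℝ} (hb : 0 < b) :
    IntegrableOn (fun ρ : ℝ => Real.exp (-(b * ρ ^ 2))) (Set.Ioi 0) := by
  simpa only [neg_mul] using (integrable_exp_neg_mul_sq hb).integrableOn

theorem norm_exp_sq_mul_dir (τ ρ θ : ℝ) :
    ‖Complex.exp (((ρ : ℂ) * dir θ) ^ 2 * τ)‖ = Real.exp (-(τ * -Real.cos (2 * θ) * ρ ^ 2)) := by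
  rw [Complex.norm_exp, Complex.re_mul_ofReal, re_sq_mul_dir]
  congr 1; ring

theorem cos_two_mul_neg {θ : ℝ} (h1 : Real.pi / 4 < θ) (h2 : θ ≤ Real.pi / 2) :
    Real.cos (2 * θ) < 0 :=
  Real.cos_neg_of_pi_div_two_lt_of_lt (by linarith) (by linarith [Real.pi_pos])

theorem norm_exp_neg_mul_dir (a ρ θ : ℝ) :
    ‖Complex.exp (-(a * ((ρ : ℂ) * dir θ)))‖ = Real.exp (-(a * (ρ * Real.cos θ))) := by
  rw [Complex.norm_exp, Complex.neg_re, Complex.re_ofReal_mul, re_mul_dir]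

/-- The heat kernel as an integral along a ray in the sector `π/4 < arg z < π/2`. -/
theorem im_rayInt_gaussian {θ : ℝ} (h1 : Real.pi / 4 < θ) (h2 : θ < Real.pi / 2) {τ : ℝ}
    (hτ : 0 < τ) {a : ℝ} (ha : 0 ≤ a) :
    (rayInt θ fun z => Complex.exp (z ^ 2 * τ) * Complex.exp (-(a * z))).im =
      √(Real.pi / τ) / 2 * Real.exp (-(a ^ 2 / (4 * τ))) := by
  set F : ℂ → ℂ := fun z => Complex.exp (z ^ 2 * τ) * Complex.exp (-(a * z)) with hF
  have hpi := Real.pi_pos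
  set b : ℝ := τ * -Real.cos (2 * θ) with hb
  have hb0 : 0 < b := mul_pos hτ (neg_pos.2 (cos_two_mul_neg h1 h2.le))
  have hbound : ∀ ρ : ℝ, 0 < ρ → ∀ φ ∈ Set.Icc θ (Real.pi / 2),
      ‖F (ρ * dir φ)‖ ≤ Real.exp (-(b * ρ ^ 2)) := by
    intro ρ hρ φ hφ
    simp only [hF]
    rw [norm_mul, norm_exp_sq_mul_dir, norm_exp_neg_mul_dir]
    have hc : 0 ≤ Real.cos φ :=
      Real.cos_nonneg_of_neg_pi_div_two_le_of_le (by linarith [hφ.1]) hφ.2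
    have hle : Real.cos (2 * φ) ≤ Real.cos (2 * θ) :=
      Real.cos_le_cos_of_nonneg_of_le_pi (by linarith) (by linarith [hφ.2]) (by linarith [hφ.1])
    rw [← Real.exp_add]
    apply Real.exp_le_exp.2
    have e1 : 0 ≤ a * (ρ * Real.cos φ) := by positivity
    have e2 : b * ρ ^ 2 ≤ τ * -Real.cos (2 * φ) * ρ ^ 2 := by
      rw [hb]; gcongr
    linarith
  have hcont : Continuous F := by simp only [hF]; fun_prop
  have hint : ∀ φ ∈ Set.Icc θ (Real.pi / 2),
      IntegrableOn (fun ρ : ℝ => F (ρ * dir φ)) (Set.Ioi 0) := by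
    intro φ hφ
    refine (integrableOn_exp_neg_sq hb0).mono'
      (hcont.comp (by fun_prop)).aestronglyMeasurable ?_
    filter_upwards [ae_restrict_mem measurableSet_Ioi] with ρ hρ using hbound ρ hρ φ hφ
  have hlim0 : Tendsto (fun ρ => ρ * Real.exp (-(b * ρ ^ 2))) (𝓝[>] 0) (𝓝 0) := by
    have : Continuous fun ρ : ℝ => ρ * Real.exp (-(b * ρ ^ 2)) := by fun_prop
    have h := this.tendsto 0
    simp only [zero_mul] at h
    exact h.mono_left nhdsWithin_le_nhds
  have hlim1 : Tendsto (fun ρ => ρ * Real.exp (-(b * ρ ^ 2))) atTop (𝓝 0) := by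
    have h := rpow_mul_exp_neg_mul_sq_isLittleO_exp_neg hb0 1
    have h3 := h.trans_tendsto
      (Real.tendsto_exp_atBot.comp (tendsto_id.const_mul_atTop_of_neg (by norm_num)))
    simpa using h3
  have rot := rayInt_eq_rayInt (F := F) h2.le
    (fun ρ _ φ _ => by simp only [hF]; fun_prop)
    (hint θ ⟨le_rfl, h2.le⟩) (hint _ ⟨h2.le, le_rfl⟩) hbound hlim0 hlim1
  rw [rot]
  -- On the imaginary axis z = iρ the integrand is a Gaussian times a character. The factor i from
  -- dz turns the imaginary part into a real part.
  set H : ℝ → ℂ := fun ρ => Complex.exp (Complex.I * (-a : ℝ) * ρ) *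
    Complex.exp (-(τ : ℂ) * ρ ^ 2) with hH
  have hHint : Integrable H := by
    refine (integrable_exp_neg_mul_sq hτ).mono' (by simp only [hH]; fun_prop)
      (Eventually.of_forall fun ρ => le_of_eq ?_)
    simp only [hH]
    rw [norm_mul, norm_cexp_neg_mul_sq, Complex.norm_exp]
    simp
  have e1 : rayInt (Real.pi / 2) F = Complex.I * ∫ ρ in Set.Ioi (0 : ℝ), H ρ := by
    rw [rayInt, dir_pi_div_two, integral_mul_const, mul_comm]
    congr 1
    apply setIntegral_congr_fun measurableSet_Ioi
    intro ρ _
    simp only [hF, hH]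
    rw [← Complex.exp_add, ← Complex.exp_add]
    congr 1
    rw [mul_pow, Complex.I_sq]
    push_cast; ring
  -- The real part is even, so the half-line integral is half of the Fourier transform of the
  -- Gaussian.
  have hre : ∀ ρ : ℝ, (H ρ).re = (fun r : ℝ => (H r).re) |ρ| := by
    intro ρ
    rcases le_total 0 ρ with h | h
    · simp only [abs_of_nonneg h]
    · simp only [abs_of_nonpos h, hH]
      rw [← Complex.conj_re, map_mul, ← Complex.exp_conj, ← Complex.exp_conj]
      congr 3 <;> simp
  have e2 : (∫ ρ, H ρ).re = 2 * (∫ ρ in Set.Ioi (0 : ℝ), H ρ).re := by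
    have r1 : (∫ ρ, H ρ).re = ∫ ρ, (H ρ).re := (integral_re hHint).symm
    have r2 : (∫ ρ in Set.Ioi (0 : ℝ), H ρ).re = ∫ ρ in Set.Ioi (0 : ℝ), (H ρ).re :=
      (integral_re hHint.integrableOn).symm
    rw [r1, r2, ← integral_comp_abs (f := fun r : ℝ => (H r).re)]
    exact integral_congr_ae (Eventually.of_forall hre)
  have e3 : ∫ ρ, H ρ = ((√(Real.pi / τ) * Real.exp (-(a ^ 2 / (4 * τ))) : ℝ) : ℂ) := by
    have := fourierIntegral_gaussian (b := (τ : ℂ)) (by simpa using hτ) ((-a : ℝ) : ℂ)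
    simp only [hH]
    rw [this]
    push_cast
    congr 1
    · rw [Real.sqrt_eq_rpow, Complex.ofReal_cpow (by positivity)]
      push_cast; rfl
    · congr 1; ring
  rw [e1, Complex.I_mul_im]
  rw [e3, Complex.ofReal_re] at e2
  linarith

/-- The value of `∫ 2 z e^{z² τ} dz` along a ray in the sector where it converges. -/
theorem rayInt_two_mul_exp {θ : ℝ} (h1 : Real.pi / 4 < θ) (h2 : θ < Real.pi / 2) {τ : ℝ}
    (hτ : 0 < τ) :
    (rayInt θ fun z => 2 * z * Complex.exp (z ^ 2 * τ)) = ((-τ⁻¹ : ℝ) : ℂ) := by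
  have hre : 0 < (-(dir θ ^ 2 * τ)).re := by
    have := re_sq_mul_dir 1 θ
    simp only [Complex.ofReal_one, one_mul, one_pow] at this
    rw [Complex.neg_re, Complex.re_mul_ofReal, this]
    have := cos_two_mul_neg h1 h2.le
    nlinarith
  have h := integral_mul_cexp_neg_mul_sq hre
  have e : (rayInt θ fun z => 2 * z * Complex.exp (z ^ 2 * τ)) =
      2 * dir θ ^ 2 * (2 * -(dir θ ^ 2 * τ))⁻¹ := by
    rw [rayInt, ← h, ← integral_const_mul]
    apply setIntegral_congr_fun measurableSet_Ioi
    intro ρ _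
    simp only
    rw [show (ρ * dir θ) ^ 2 * (τ : ℂ) = - -(dir θ ^ 2 * τ) * (ρ : ℂ) ^ 2 by ring]
    ring
  have e' : (2 * dir θ ^ 2 * (2 * -(dir θ ^ 2 * τ))⁻¹ : ℂ) = ((-τ⁻¹ : ℝ) : ℂ) := by
    have := dir_ne_zero θ
    have hτ' : (τ : ℂ) ≠ 0 := by exact_mod_cast hτ.ne'
    push_cast
    field_simp
  rw [e, e']

/-! ### The characteristic function -/

/-- The characteristic function `2 z + β e^{-x₀ z}` of the problem, with `λ = z²` the spectral
parameter. -/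
def charFn (β x₀ : ℝ) (z : ℂ) : ℂ := 2 * z + β * Complex.exp (-(x₀ * z))

theorem continuous_charFn (β x₀ : ℝ) : Continuous (charFn β x₀) := by
  unfold charFn; fun_prop

theorem charFn_ofReal (β x₀ r : ℝ) :
    charFn β x₀ r = ((2 * r + β * Real.exp (-(x₀ * r)) : ℝ) : ℂ) := by
  unfold charFn; push_cast; rfl

/-- A zero of the characteristic function in the closed right half plane. -/
theorem le_of_charFn_eq_zero {β x₀ ρ φ : ℝ} (hβ : 0 < β) (hx₀ : 0 < x₀) (hρ : 0 ≤ ρ)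
    (hφ0 : 0 ≤ φ) (hφ1 : φ ≤ Real.pi / 2) (h : charFn β x₀ (ρ * dir φ) = 0) :
    Real.pi - φ ≤ x₀ * ρ * Real.sin φ ∧
      2 * (x₀ * ρ) * Real.exp (x₀ * ρ * Real.cos φ) = β * x₀ := by
  have hpi := Real.pi_pos
  -- The equation D(z) = 0 in the form 2z e^{x₀ z} = -β. Its modulus gives the second claim; its
  -- argument forces φ + x₀ρ sin φ to be an odd multiple of π, hence at least π.
  have h1 : 2 * (ρ * dir φ) * Complex.exp (x₀ * (ρ * dir φ)) = -β := by
    have e : Complex.exp (-(x₀ * (ρ * dir φ))) * Complex.exp (x₀ * (ρ * dir φ)) = 1 := by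
      rw [← Complex.exp_add]; simp
    unfold charFn at h
    linear_combination Complex.exp (x₀ * (ρ * dir φ)) * h - β * e
  have h2 : 2 * ρ * Real.exp (x₀ * ρ * Real.cos φ) = β := by
    have := congrArg norm h1
    rw [norm_mul, norm_mul, norm_mul_dir hρ, Complex.norm_exp, Complex.re_ofReal_mul, re_mul_dir,
      norm_neg, Complex.norm_real, Real.norm_of_nonneg hβ.le] at this
    rw [← this, mul_assoc x₀]
    simp
  have h3 : ((2 * ρ * Real.exp (x₀ * ρ * Real.cos φ) : ℝ) : ℂ) *
      Complex.exp ((φ + x₀ * ρ * Real.sin φ : ℝ) * Complex.I) = -β := by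
    rw [← h1]
    have hd : dir φ = Real.cos φ + Real.sin φ * Complex.I := by
      rw [← dir_re, ← dir_im, Complex.re_add_im]
    have e2 : Complex.exp (x₀ * (ρ * dir φ)) = Complex.exp ((x₀ * ρ * Real.cos φ : ℝ)) *
        Complex.exp ((x₀ * ρ * Real.sin φ : ℝ) * Complex.I) := by
      rw [← Complex.exp_add, hd]
      congr 1
      push_cast; ring
    have e3 : Complex.exp ((φ + x₀ * ρ * Real.sin φ : ℝ) * Complex.I) =
        dir φ * Complex.exp ((x₀ * ρ * Real.sin φ : ℝ) * Complex.I) := by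
      rw [dir, ← Complex.exp_add]
      congr 1
      push_cast; ring
    rw [e2, e3]
    push_cast; ring
  have h4 : Real.cos (φ + x₀ * ρ * Real.sin φ) = -1 := by
    rw [h2] at h3
    have := congrArg Complex.re h3
    rw [Complex.re_ofReal_mul, Complex.exp_ofReal_mul_I_re, Complex.neg_re,
      Complex.ofReal_re] at this
    have hb : β * (Real.cos (φ + x₀ * ρ * Real.sin φ) + 1) = 0 := by linarith
    rcases mul_eq_zero.1 hb with hb | hb
    · exact absurd hb hβ.ne'
    · linarith
  have hs : 0 ≤ Real.sin φ := Real.sin_nonneg_of_nonneg_of_le_pi hφ0 (by linarith)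
  refine ⟨?_, by rw [← h2]; ring⟩
  by_contra hcon
  have hlt := Real.cos_lt_cos_of_nonneg_of_le_pi
    (by positivity : 0 ≤ φ + x₀ * ρ * Real.sin φ) le_rfl (by linarith)
  rw [Real.cos_pi, h4] at hlt
  exact lt_irrefl _ hlt

/-- Below the critical value `betaOne x₀`, the characteristic function has no zero in a sector
whose half-opening exceeds `π / 4`. -/
theorem exists_sector_charFn_ne_zero {β x₀ : ℝ} (hβ : 0 < β) (hx₀ : 0 < x₀)
    (hβ₁ : β < betaOne x₀) : ∃ θ : ℝ, Real.pi / 4 < θ ∧ θ < Real.pi / 2 ∧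
      ∀ ρ : ℝ, 0 ≤ ρ → ∀ φ ∈ Set.Icc 0 θ, charFn β x₀ (ρ * dir φ) ≠ 0 := by
  have hpi := Real.pi_pos
  have hs2 : (0 : ℝ) < √2 := by positivity
  have hsq : √2 * √2 = 2 := Real.mul_self_sqrt (by norm_num)
  have hcrit : β * x₀ < 3 * Real.pi / √2 * Real.exp (3 * Real.pi / 4) := by
    have := mul_lt_mul_of_pos_right hβ₁ hx₀
    rwa [betaOne, div_mul_cancel₀ _ hx₀.ne'] at this
  have hsqrt : 3 * Real.pi / √2 = 2 * (3 * Real.pi / 4 * √2) := by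
    rw [div_eq_iff hs2.ne']
    linear_combination (-(3 * Real.pi / 2)) * hsq
  -- A zero of argument φ ∈ (0, π/2) has x₀ρ ≥ w φ, hence β x₀ ≥ g φ. The critical constant is
  -- exactly g(π/4), so by continuity the strict inequality on β persists slightly beyond π/4.
  set w : ℝ → ℝ := fun φ => (Real.pi - φ) / Real.sin φ with hw
  set g : ℝ → ℝ := fun φ => 2 * w φ * Real.exp (w φ * Real.cos φ) with hg
  have hwc : ContinuousAt w (Real.pi / 4) := by
    apply ContinuousAt.div (by fun_prop) (by fun_prop)
    rw [Real.sin_pi_div_four]; positivity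
  have hgc : ContinuousAt g (Real.pi / 4) := by
    apply ContinuousAt.mul (continuousAt_const.mul hwc)
    exact Real.continuous_exp.continuousAt.comp (hwc.mul Real.continuous_cos.continuousAt)
  have hw4 : w (Real.pi / 4) = 3 * Real.pi / 4 * √2 := by
    simp only [hw]
    rw [Real.sin_pi_div_four, div_eq_iff (by positivity)]
    linear_combination (-(3 * Real.pi / 8)) * hsq
  have hg4 : β * x₀ < g (Real.pi / 4) := by
    simp only [hg]
    rw [hw4, ← hsqrt, Real.cos_pi_div_four]
    refine hcrit.trans_le (le_of_eq ?_)
    congr 2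
    linear_combination (-(3 * Real.pi / 8)) * hsq
  obtain ⟨ε, hε, hball⟩ := Metric.eventually_nhds_iff.1 (hgc.eventually_const_lt hg4)
  refine ⟨Real.pi / 4 + min (ε / 2) (Real.pi / 8), ?_, ?_, ?_⟩
  · have : 0 < min (ε / 2) (Real.pi / 8) := lt_min (by linarith) (by linarith)
    linarith
  · have := min_le_right (ε / 2) (Real.pi / 8)
    linarith
  intro ρ hρ φ hφ h0
  have hφ2 : φ < Real.pi / 2 := by
    have := min_le_right (ε / 2) (Real.pi / 8)
    linarith [hφ.2]
  obtain ⟨hl, he⟩ := le_of_charFn_eq_zero hβ hx₀ hρ hφ.1 hφ2.le h0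
  have hX : 0 ≤ x₀ * ρ := by positivity
  -- Up to π/4 the sine is at most √2/2 and the cosine at least √2/2, so a zero would already force
  -- β x₀ up to the critical constant. Beyond π/4 the continuity of g is used.
  rcases le_total φ (Real.pi / 4) with h | h
  · have hsin : Real.sin φ ≤ √2 / 2 := by
      rw [← Real.sin_pi_div_four]
      exact Real.sin_le_sin_of_le_of_le_pi_div_two (by linarith [hφ.1]) (by linarith) h
    have hcos : √2 / 2 ≤ Real.cos φ := by
      rw [← Real.cos_pi_div_four]
      exact Real.cos_le_cos_of_nonneg_of_le_pi hφ.1 (by linarith) h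
    have h1 : 3 * Real.pi / 4 ≤ x₀ * ρ * (√2 / 2) :=
      le_trans (by linarith) (mul_le_mul_of_nonneg_left hsin hX)
    have h2 : 3 * Real.pi / 4 ≤ x₀ * ρ * Real.cos φ :=
      h1.trans (mul_le_mul_of_nonneg_left hcos hX)
    have h3 : 3 * Real.pi / 4 * √2 ≤ x₀ * ρ := by
      have := mul_le_mul_of_nonneg_right h1 hs2.le
      have e : x₀ * ρ * (√2 / 2) * √2 = x₀ * ρ := by
        linear_combination (x₀ * ρ / 2) * hsq
      linarith
    have h4 : 3 * Real.pi / √2 * Real.exp (3 * Real.pi / 4) ≤ β * x₀ := by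
      rw [← he, hsqrt]
      gcongr
    linarith
  · have hd : dist φ (Real.pi / 4) < ε := by
      rw [Real.dist_eq, abs_of_nonneg (by linarith)]
      have := min_le_left (ε / 2) (Real.pi / 8)
      linarith [hφ.2]
    have h1 := hball hd
    have hsin : 0 < Real.sin φ := Real.sin_pos_of_pos_of_lt_pi (by linarith) (by linarith)
    have hcos : 0 < Real.cos φ := Real.cos_pos_of_mem_Ioo ⟨by linarith, hφ2⟩
    have h2 : w φ ≤ x₀ * ρ := by
      simp only [hw]
      rwa [div_le_iff₀ hsin]
    have h3 : g φ ≤ β * x₀ := by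
      rw [← he]
      simp only [hg]
      gcongr
    linarith

/-- Where it has no zero, the characteristic function is bounded from below on a sector. -/
theorem exists_le_norm_charFn {β x₀ θ : ℝ} (hβ : 0 < β) (hx₀ : 0 < x₀) (hθ0 : 0 ≤ θ)
    (hθ : θ < Real.pi / 2)
    (h : ∀ ρ : ℝ, 0 ≤ ρ → ∀ φ ∈ Set.Icc 0 θ, charFn β x₀ (ρ * dir φ) ≠ 0) :
    ∃ c : ℝ, 0 < c ∧ ∀ ρ : ℝ, 0 ≤ ρ → ∀ φ ∈ Set.Icc 0 θ,
      c * (1 + ρ) ≤ ‖charFn β x₀ (ρ * dir φ)‖ := by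
  have hpi := Real.pi_pos
  -- For ρ ≥ β + 1 the linear term dominates: |D| ≥ 2ρ - β ≥ (1 + ρ)/2. For smaller ρ compactness
  -- gives a positive minimum.
  set R : ℝ := β + 1 with hR
  have hK : IsCompact (Set.Icc (0 : ℝ) R ×ˢ Set.Icc (0 : ℝ) θ) := isCompact_Icc.prod isCompact_Icc
  have hcont : Continuous fun p : ℝ × ℝ => ‖charFn β x₀ (p.1 * dir p.2)‖ := by
    have h1 := continuous_charFn β x₀
    have h2 := continuous_dir
    fun_prop
  obtain ⟨p, hp, hmin⟩ := hK.exists_isMinOn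
    ⟨(0, 0), ⟨le_rfl, by positivity⟩, ⟨le_rfl, hθ0⟩⟩ hcont.continuousOn
  set c₁ : ℝ := ‖charFn β x₀ (p.1 * dir p.2)‖ with hc₁
  have hc₁0 : 0 < c₁ := norm_pos_iff.2 (h p.1 hp.1.1 p.2 hp.2)
  have hR0 : 0 < 1 + R := by rw [hR]; positivity
  refine ⟨min (1 / 2) (c₁ / (1 + R)), lt_min (by norm_num) (by positivity), ?_⟩
  intro ρ hρ φ hφ
  rcases le_total ρ R with hle | hle
  · have h1 : c₁ ≤ ‖charFn β x₀ (ρ * dir φ)‖ := 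
      isMinOn_iff.1 hmin (ρ, φ) (Set.mk_mem_prod ⟨hρ, hle⟩ hφ)
    calc min (1 / 2) (c₁ / (1 + R)) * (1 + ρ) ≤ c₁ / (1 + R) * (1 + R) := by
          gcongr
          exact min_le_right _ _
      _ = c₁ := div_mul_cancel₀ _ hR0.ne'
      _ ≤ _ := h1
  · have hcos : 0 ≤ Real.cos φ :=
      Real.cos_nonneg_of_neg_pi_div_two_le_of_le (by linarith [hφ.1]) (by linarith [hφ.2])
    have h1 : ‖(β : ℂ) * Complex.exp (-(x₀ * ((ρ : ℂ) * dir φ)))‖ ≤ β := by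
      rw [norm_mul, Complex.norm_real, Real.norm_of_nonneg hβ.le, norm_exp_neg_mul_dir]
      have : Real.exp (-(x₀ * (ρ * Real.cos φ))) ≤ 1 := by
        apply Real.exp_le_one_iff.2
        have : 0 ≤ x₀ * (ρ * Real.cos φ) := by positivity
        linarith
      nlinarith
    have h2 : ‖(2 : ℂ) * (ρ * dir φ)‖ = 2 * ρ := by
      rw [norm_mul, norm_mul_dir hρ]; simp
    have h3 : 2 * ρ - β ≤ ‖charFn β x₀ (ρ * dir φ)‖ := by
      have := norm_sub_le_norm_add ((2 : ℂ) * (ρ * dir φ))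
        ((β : ℂ) * Complex.exp (-(x₀ * ((ρ : ℂ) * dir φ))))
      rw [h2] at this
      unfold charFn
      linarith
    have h4 : min (1 / 2) (c₁ / (1 + R)) * (1 + ρ) ≤ 1 / 2 * (1 + ρ) := by
      gcongr
      exact min_le_left _ _
    linarith

/-- The inverse Laplace-type integral of `e^{-A z} / (2 z + β e^{-x₀ z})` at time zero vanishes. -/
theorem im_rayInt_exp_div_charFn {β x₀ θ c : ℝ} (hθ0 : 0 ≤ θ) (hθ : θ < Real.pi / 2) (hc : 0 < c)
    (h : ∀ ρ : ℝ, 0 ≤ ρ → ∀ φ ∈ Set.Icc 0 θ, c * (1 + ρ) ≤ ‖charFn β x₀ (ρ * dir φ)‖)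
    {A : ℝ} (hA : 0 < A) :
    (rayInt θ fun z => Complex.exp (-(A * z)) / charFn β x₀ z).im = 0 := by
  have hpi := Real.pi_pos
  set F : ℂ → ℂ := fun z => Complex.exp (-(A * z)) / charFn β x₀ z with hF
  have hcosθ : 0 < Real.cos θ := Real.cos_pos_of_mem_Ioo ⟨by linarith, hθ⟩
  set b : ℝ := A * Real.cos θ with hb
  have hb0 : 0 < b := mul_pos hA hcosθ
  have hne : ∀ ρ : ℝ, 0 ≤ ρ → ∀ φ ∈ Set.Icc 0 θ, charFn β x₀ (ρ * dir φ) ≠ 0 := by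
    intro ρ hρ φ hφ
    have := h ρ hρ φ hφ
    exact norm_pos_iff.1 (lt_of_lt_of_le (by positivity) this)
  have hbound : ∀ ρ : ℝ, 0 < ρ → ∀ φ ∈ Set.Icc 0 θ,
      ‖F (ρ * dir φ)‖ ≤ Real.exp (-b * ρ) / c := by
    intro ρ hρ φ hφ
    have h1 := h ρ hρ.le φ hφ
    simp only [hF]
    rw [norm_div, norm_exp_neg_mul_dir]
    have hcos : Real.cos θ ≤ Real.cos φ :=
      Real.cos_le_cos_of_nonneg_of_le_pi hφ.1 (by linarith) hφ.2
    have h2 : c ≤ ‖charFn β x₀ (ρ * dir φ)‖ := le_trans (by nlinarith) h1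
    have h3 : b * ρ ≤ A * (ρ * Real.cos φ) := by
      rw [hb, mul_assoc, mul_comm (Real.cos θ)]
      gcongr
    exact div_le_div₀ (Real.exp_pos _).le (Real.exp_le_exp.2 (by linarith)) hc h2
  have hmeas : ∀ φ : ℝ, Measurable fun ρ : ℝ => F (ρ * dir φ) := by
    intro φ
    have h1 := (continuous_charFn β x₀).measurable
    simp only [hF]
    fun_prop
  have hint : ∀ φ ∈ Set.Icc 0 θ, IntegrableOn (fun ρ : ℝ => F (ρ * dir φ)) (Set.Ioi 0) := by
    intro φ hφ
    refine ((integrableOn_exp_mul_Ioi (a := -b) (by linarith) 0).div_const c).mono'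
      (hmeas φ).aestronglyMeasurable ?_
    filter_upwards [ae_restrict_mem measurableSet_Ioi] with ρ hρ using hbound ρ hρ φ hφ
  have hlim0 : Tendsto (fun ρ => ρ * (Real.exp (-b * ρ) / c)) (𝓝[>] 0) (𝓝 0) := by
    have : Continuous fun ρ : ℝ => ρ * (Real.exp (-b * ρ) / c) := by fun_prop
    have h := this.tendsto 0
    simp only [zero_mul] at h
    exact h.mono_left nhdsWithin_le_nhds
  have hlim1 : Tendsto (fun ρ => ρ * (Real.exp (-b * ρ) / c)) atTop (𝓝 0) := by
    have h := (tendsto_rpow_mul_exp_neg_mul_atTop_nhds_zero 1 b hb0).div_const c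
    simpa [mul_div_assoc] using h
  have hdiff : ∀ ρ : ℝ, 0 < ρ → ∀ φ ∈ Set.Icc 0 θ, DifferentiableAt ℂ F (ρ * dir φ) := by
    intro ρ hρ φ hφ
    apply DifferentiableAt.div (by fun_prop) _ (hne ρ hρ.le φ hφ)
    unfold charFn
    fun_prop
  have rot := rayInt_eq_rayInt (F := F) hθ0 hdiff (hint 0 ⟨le_rfl, hθ0⟩) (hint θ ⟨hθ0, le_rfl⟩)
    hbound hlim0 hlim1
  -- On the positive real axis both numerator and denominator are real.
  rw [← rot]
  have e : rayInt 0 F = ((∫ ρ in Set.Ioi (0 : ℝ), Real.exp (-(A * ρ)) /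
      (2 * ρ + β * Real.exp (-(x₀ * ρ))) : ℝ) : ℂ) := by
    rw [rayInt, ← integral_complex_ofReal]
    apply setIntegral_congr_fun measurableSet_Ioi
    intro ρ _
    simp only [hF, dir_zero, mul_one, charFn_ofReal]
    push_cast; rfl
  rw [e, Complex.ofReal_im]

/-! ### Pairing with exponential kernels -/

/-- The pairing `∫ f(ξ) e^{-|ξ - a| z} dξ`. -/
def lap (f : ℝ → ℝ) (a : ℝ) (z : ℂ) : ℂ := ∫ ξ, (f ξ : ℂ) * kern a z ξ

/-- `H1` is a real space, so a complex test function is handled through two real ones: c = 1 gives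
the real part and c = -i the imaginary part. -/
theorem kern_eq_reKern (a : ℝ) (z : ℂ) (ξ : ℝ) :
    kern a z ξ = reKern a z 1 ξ + reKern a z (-Complex.I) ξ * Complex.I := by
  apply Complex.ext <;> simp [reKern]

theorem integrable_rep_mul_kern (v : H1) (a : ℝ) {z : ℂ} (hz : 0 < z.re) :
    Integrable fun ξ => (H1.rep v ξ : ℂ) * kern a z ξ := by
  have h : ∀ c : ℂ, Integrable fun ξ => ((H1.rep v ξ * reKern a z c ξ : ℝ) : ℂ) := by
    intro c
    have := H1.integrable_rep_mul_rep v (kernH1 a z hz c)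
    rw [rep_kernH1] at this
    exact this.ofReal
  refine ((h 1).add ((h (-Complex.I)).mul_const Complex.I)).congr
    (Eventually.of_forall fun ξ => ?_)
  simp only [Pi.add_apply]
  rw [kern_eq_reKern]
  push_cast; ring

theorem integrable_mul_kern {f : ℝ → ℝ} (hf : Integrable f) (a : ℝ) {z : ℂ} (hz : 0 < z.re) :
    Integrable fun ξ => (f ξ : ℂ) * kern a z ξ :=
  hf.ofReal.mul_bdd (c := 1) (continuous_kern a z).aestronglyMeasurable
    (Eventually.of_forall fun ξ => norm_kern_le_one a hz.le ξ)

theorem integral_mul_reKern {f : ℝ → ℝ} {a : ℝ} {z : ℂ}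
    (hf : Integrable fun ξ => (f ξ : ℂ) * kern a z ξ) (c : ℂ) :
    ∫ ξ, f ξ * reKern a z c ξ = (c * lap f a z).re := by
  rw [lap, ← integral_const_mul]
  refine Eq.trans ?_ (integral_re (hf.const_mul c))
  refine integral_congr_ae (Eventually.of_forall fun ξ => ?_)
  simp only
  change _ = (c * ((f ξ : ℂ) * kern a z ξ)).re
  rw [mul_left_comm, Complex.re_ofReal_mul]
  rfl

theorem embed_kernH1 (v : H1) (a : ℝ) (z : ℂ) (hz : 0 < z.re) (c : ℂ) :
    embed v (kernH1 a z hz c) = (c * lap (H1.rep v) a z).re := by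
  rw [embed_apply, rep_kernH1, integral_mul_reKern (integrable_rep_mul_kern v a hz)]

theorem ofL1_kernH1 (f : ℝ → ℝ) (hf : Integrable f) (a : ℝ) (z : ℂ) (hz : 0 < z.re) (c : ℂ) :
    ofL1 f hf (kernH1 a z hz c) = (c * lap f a z).re := by
  rw [ofL1_apply, rep_kernH1, integral_mul_reKern (integrable_mul_kern hf a hz)]

theorem lap_rep_eq (v : H1) (a : ℝ) (z : ℂ) (hz : 0 < z.re) :
    lap (H1.rep v) a z = (embed v (kernH1 a z hz 1) : ℂ) +
      (embed v (kernH1 a z hz (-Complex.I)) : ℂ) * Complex.I := by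
  rw [embed_kernH1, embed_kernH1]
  apply Complex.ext <;> simp

theorem lap_eq_ofL1 (f : ℝ → ℝ) (hf : Integrable f) (a : ℝ) (z : ℂ) (hz : 0 < z.re) :
    lap f a z = (ofL1 f hf (kernH1 a z hz 1) : ℂ) +
      (ofL1 f hf (kernH1 a z hz (-Complex.I)) : ℂ) * Complex.I := by
  rw [ofL1_kernH1, ofL1_kernH1]
  apply Complex.ext <;> simp

theorem norm_lap_le_integral {f : ℝ → ℝ} (hf : Integrable f) (a : ℝ) {z : ℂ} (hz : 0 ≤ z.re) :
    ‖lap f a z‖ ≤ ∫ ξ, |f ξ| := by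
  refine (norm_integral_le_integral_norm _).trans (integral_mono_of_nonneg
    (Eventually.of_forall fun _ => norm_nonneg _) hf.abs (Eventually.of_forall fun ξ => ?_))
  simp only
  rw [norm_mul, Complex.norm_real, Real.norm_eq_abs]
  exact mul_le_of_le_one_right (abs_nonneg _) (norm_kern_le_one a hz ξ)

theorem norm_ofReal_add_ofReal_mul_I_le (x y : ℝ) : ‖(x : ℂ) + y * Complex.I‖ ≤ |x| + |y| := by
  refine (norm_add_le _ _).trans ?_
  simp

/-- Only the H⁻¹ norm of a solution is controlled as t → 0. The price is the H¹ norm of the kernel,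
which grows like ρ^{1/2} along a ray; the Gaussian absorbs this growth. -/
theorem norm_lap_le_dual (v : H1) (a : ℝ) (z : ℂ) (hz : 0 < z.re) :
    ‖lap (H1.rep v) a z‖ ≤ 2 * ‖embed v‖ * ((1 + ‖z‖) / √z.re) := by
  rw [lap_rep_eq v a z hz]
  refine (norm_ofReal_add_ofReal_mul_I_le _ _).trans ?_
  have h : ∀ c : ℂ, ‖c‖ = 1 → |embed v (kernH1 a z hz c)| ≤ ‖embed v‖ * ((1 + ‖z‖) / √z.re) := by
    intro c hc
    refine ((embed v).le_opNorm _).trans ?_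
    have := norm_kernH1_le a z hz c
    rw [hc, one_mul] at this
    gcongr
  have h1 := h 1 (by simp)
  have h2 := h (-Complex.I) (by simp)
  linarith

/-- Cauchy-Schwarz in L² avoids the factor 1 + |z|. This sharper power is needed as t → T, when the
Gaussian disappears. -/
theorem norm_lap_le_L2 (v : H1) (a : ℝ) (z : ℂ) (hz : 0 < z.re) :
    ‖lap (H1.rep v) a z‖ ≤ 2 * ‖v‖ * (1 / √z.re) := by
  rw [lap_rep_eq v a z hz]
  refine (norm_ofReal_add_ofReal_mul_I_le _ _).trans ?_
  have h6 : ‖H1.toL2 v‖ ≤ ‖v‖ := by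
    apply le_of_sq_le_sq _ (norm_nonneg v)
    rw [H1.norm_sq_eq]
    linarith [sq_nonneg ‖H1.weakDeriv v‖]
  have h : ∀ c : ℂ, ‖c‖ = 1 → |embed v (kernH1 a z hz c)| ≤ ‖v‖ * (1 / √z.re) := by
    intro c hc
    change |inner ℝ (H1.toL2 v) (H1.toL2 (kernH1 a z hz c))| ≤ _
    refine (abs_real_inner_le_norm _ _).trans ?_
    have := norm_toL2_kernH1_le a z hz c
    rw [hc] at this
    gcongr
  have h1 := h 1 (by simp)
  have h2 := h (-Complex.I) (by simp)
  linarith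

theorem aestronglyMeasurable_lap {f : ℝ → ℝ} (hf : AEStronglyMeasurable f volume) (a θ : ℝ)
    {μ : Measure ℝ} [SFinite μ] :
    AEStronglyMeasurable (fun ρ : ℝ => lap f a (ρ * dir θ)) μ := by
  have h1 : AEStronglyMeasurable (fun p : ℝ × ℝ => (f p.2 : ℂ)) (μ.prod volume) :=
    Complex.continuous_ofReal.comp_aestronglyMeasurable hf.comp_snd
  have h2 : Continuous fun p : ℝ × ℝ => kern a (p.1 * dir θ) p.2 := by
    unfold kern; fun_prop
  exact (h1.mul h2.aestronglyMeasurable).integral_prod_right'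

/-! ### Evolution of the pairings -/

namespace IsSolution

variable {β x₀ : ℝ} {U₀ : HNeg1} {u : ℝ → H1}

/-- The equation tested with the kernel: `opA_kernH1` gives the first two terms, and the Dirac
source at 0 evaluates the kernel there. -/
theorem hasDerivAt_lap (hu : IsSolution β x₀ U₀ u) (a : ℝ) (z : ℂ) (hz : 0 < z.re) {t : ℝ}
    (ht : 0 < t) :
    HasDerivAt (fun τ => lap (H1.rep (u τ)) a z)
      (z ^ 2 * lap (H1.rep (u t)) a z - 2 * z * H1.rep (u t) a -
        β * H1.rep (u t) x₀ * kern a z 0) t := by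
  have hd : ∀ c : ℂ, HasDerivAt (fun τ => embed (u τ) (kernH1 a z hz c))
      (c * (z ^ 2 * lap (H1.rep (u t)) a z - 2 * z * H1.rep (u t) a -
        β * H1.rep (u t) x₀ * kern a z 0)).re t := by
    intro c
    have h1 := (hu.hasDerivAt t ht).clm_apply (hasDerivAt_const t (kernH1 a z hz c))
    refine h1.congr_deriv ?_
    rw [map_zero, add_zero, neg_apply, opAβ_apply,
      add_apply, smul_apply, dirac_apply, opA_kernH1,
      embed_kernH1, rep_kernH1, reKern, smul_eq_mul]
    have e : c * (z ^ 2 * lap (H1.rep (u t)) a z - 2 * z * H1.rep (u t) a -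
        β * H1.rep (u t) x₀ * kern a z 0) =
        z * (z * c) * lap (H1.rep (u t)) a z - ((2 * H1.rep (u t) a : ℝ) : ℂ) * (z * c) -
          ((β * H1.rep (u t) x₀ : ℝ) : ℂ) * (c * kern a z 0) := by
      push_cast; ring
    rw [e, Complex.sub_re, Complex.sub_re, Complex.re_ofReal_mul, Complex.re_ofReal_mul]
    ring
  have h := (hd 1).ofReal_comp.add ((hd (-Complex.I)).ofReal_comp.mul_const Complex.I)
  have ef : (fun τ => lap (H1.rep (u τ)) a z) = fun τ =>
      ((embed (u τ) (kernH1 a z hz 1) : ℝ) : ℂ) +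
        ((embed (u τ) (kernH1 a z hz (-Complex.I)) : ℝ) : ℂ) * Complex.I := by
    funext τ; exact lap_rep_eq (u τ) a z hz
  rw [ef]
  refine h.congr_deriv ?_
  apply Complex.ext <;> simp

end IsSolution

/-- The multiplier `β e^{-|x| z} / (2 z + β e^{-x₀ z})`. -/
def mult (β x₀ x : ℝ) (z : ℂ) : ℂ := β * kern x z 0 / charFn β x₀ z

/-- The pairing of `f` with (`2 z` times) the resolvent kernel of the problem at `x`. -/
def resPair (β x₀ : ℝ) (f : ℝ → ℝ) (x : ℝ) (z : ℂ) : ℂ :=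
  lap f x z - mult β x₀ x z * lap f x₀ z

/-- At the sensor point the two pairings coincide and 1 - `mult` = 2z / `charFn`. The zero at z = 0,
the point governing large times, is what gives the faster rate. -/
theorem resPair_self {β x₀ : ℝ} (hx₀ : 0 ≤ x₀) (f : ℝ → ℝ) {z : ℂ} (hz : charFn β x₀ z ≠ 0) :
    resPair β x₀ f x₀ z = 2 * z * lap f x₀ z / charFn β x₀ z := by
  unfold resPair mult
  have : kern x₀ z 0 = Complex.exp (-(x₀ * z)) := by
    simp [kern, abs_of_nonneg hx₀]
  rw [this, eq_div_iff hz, sub_mul, mul_assoc, mul_comm (lap f x₀ z) (charFn β x₀ z), ← mul_assoc,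
    div_mul_cancel₀ _ hz]
  simp only [charFn]
  ring

/-- At a = x₀ the forcing is -D(z) u(t, x₀), so subtracting β e^{-|x| z} / D(z) times that pairing
removes u(t, x₀) and leaves only the wanted value u(t, x). -/
theorem IsSolution.hasDerivAt_resPair {β x₀ : ℝ} {U₀ : HNeg1} {u : ℝ → H1} (hx₀ : 0 ≤ x₀)
    (hu : IsSolution β x₀ U₀ u) (x : ℝ) (z : ℂ) (hz : 0 < z.re) (hD : charFn β x₀ z ≠ 0) {t : ℝ}
    (ht : 0 < t) :
    HasDerivAt (fun τ => resPair β x₀ (H1.rep (u τ)) x z)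
      (z ^ 2 * resPair β x₀ (H1.rep (u t)) x z - 2 * z * H1.rep (u t) x) t := by
  refine ((hu.hasDerivAt_lap x z hz ht).sub
    ((hu.hasDerivAt_lap x₀ z hz ht).const_mul (mult β x₀ x z))).congr_deriv ?_
  have hk : kern x₀ z 0 = Complex.exp (-(x₀ * z)) := by
    simp [kern, abs_of_nonneg hx₀]
  have hm : mult β x₀ x z * (2 * z + β * Complex.exp (-(x₀ * z))) = β * kern x z 0 :=
    div_mul_cancel₀ _ hD
  unfold resPair
  rw [hk]
  linear_combination (H1.rep (u t) x₀ : ℂ) * hm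

/-! ### Estimates along an admissible ray -/

/-- The ray of argument `θ` lies beyond `π / 4` and the characteristic function is bounded from
below on the sector between this ray and the positive real axis. -/
structure AdmissibleAngle (β x₀ θ c : ℝ) : Prop where
  lt_angle : Real.pi / 4 < θ
  angle_lt : θ < Real.pi / 2
  pos : 0 < c
  le_norm : ∀ ρ : ℝ, 0 ≤ ρ → ∀ φ ∈ Set.Icc 0 θ, c * (1 + ρ) ≤ ‖charFn β x₀ (ρ * dir φ)‖

theorem exists_admissibleAngle {β x₀ : ℝ} (hβ : 0 < β) (hx₀ : 0 < x₀) (hβ₁ : β < betaOne x₀) :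
    ∃ θ c : ℝ, AdmissibleAngle β x₀ θ c := by
  obtain ⟨θ, h1, h2, h3⟩ := exists_sector_charFn_ne_zero hβ hx₀ hβ₁
  obtain ⟨c, hc, h4⟩ := exists_le_norm_charFn hβ hx₀ (by linarith [Real.pi_pos]) h2 h3
  exact ⟨θ, c, h1, h2, hc, h4⟩

/-- The dominating function at the final time: ρ^{-1/2} from the L² bound on `lap`, and 1/(1 + ρ)
from the decay of `mult`. -/
theorem integrableOn_rpow_neg_half_div :
    IntegrableOn (fun ρ : ℝ => ρ ^ (-(1 / 2) : ℝ) / (1 + ρ)) (Set.Ioi 0) := by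
  have hm : Measurable fun ρ : ℝ => ρ ^ (-(1 / 2) : ℝ) / (1 + ρ) := by fun_prop
  rw [← Set.Ioc_union_Ioi_eq_Ioi (zero_le_one' ℝ)]
  refine IntegrableOn.union ?_ ?_
  · have h : IntegrableOn (fun ρ : ℝ => ρ ^ (-(1 / 2) : ℝ)) (Set.Ioc 0 1) := by
      rw [← intervalIntegrable_iff_integrableOn_Ioc_of_le zero_le_one]
      exact intervalIntegral.intervalIntegrable_rpow' (by norm_num)
    refine h.mono' hm.aestronglyMeasurable ?_
    filter_upwards [ae_restrict_mem measurableSet_Ioc] with ρ hρ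
    have h0 : 0 ≤ ρ ^ (-(1 / 2) : ℝ) := Real.rpow_nonneg hρ.1.le _
    have h1 : (0 : ℝ) < 1 + ρ := by linarith [hρ.1]
    rw [Real.norm_of_nonneg (by positivity)]
    exact div_le_self h0 (by linarith [hρ.1])
  · refine (integrableOn_Ioi_rpow_of_lt (a := -(3 / 2)) (by norm_num) zero_lt_one).mono'
      hm.aestronglyMeasurable ?_
    filter_upwards [ae_restrict_mem measurableSet_Ioi] with ρ hρ
    have hρ0 : (0 : ℝ) < ρ := lt_trans zero_lt_one hρ
    have h0 : 0 ≤ ρ ^ (-(1 / 2) : ℝ) := Real.rpow_nonneg hρ0.le _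
    rw [Real.norm_of_nonneg (by positivity),
      show (-(3 / 2) : ℝ) = -(1 / 2) - 1 by norm_num, Real.rpow_sub_one hρ0.ne']
    gcongr
    linarith

namespace AdmissibleAngle

variable {β x₀ θ c : ℝ}

theorem nonneg (h : AdmissibleAngle β x₀ θ c) : 0 ≤ θ := by
  linarith [h.lt_angle, Real.pi_pos]

theorem cos_pos (h : AdmissibleAngle β x₀ θ c) : 0 < Real.cos θ :=
  Real.cos_pos_of_mem_Ioo ⟨by linarith [h.nonneg, Real.pi_pos], h.angle_lt⟩

theorem neg_cos_pos (h : AdmissibleAngle β x₀ θ c) : 0 < -Real.cos (2 * θ) :=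
  neg_pos.2 (cos_two_mul_neg h.lt_angle h.angle_lt.le)

theorem re_pos (h : AdmissibleAngle β x₀ θ c) {ρ : ℝ} (hρ : 0 < ρ) :
    0 < ((ρ : ℂ) * dir θ).re := by
  rw [re_mul_dir]; exact mul_pos hρ h.cos_pos

theorem le_norm_ray (h : AdmissibleAngle β x₀ θ c) {ρ : ℝ} (hρ : 0 ≤ ρ) :
    c * (1 + ρ) ≤ ‖charFn β x₀ (ρ * dir θ)‖ :=
  h.le_norm ρ hρ θ ⟨h.nonneg, le_rfl⟩

theorem charFn_ne_zero (h : AdmissibleAngle β x₀ θ c) {ρ : ℝ} (hρ : 0 ≤ ρ) :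
    charFn β x₀ (ρ * dir θ) ≠ 0 :=
  norm_pos_iff.1 (lt_of_lt_of_le (mul_pos h.pos (by linarith)) (h.le_norm_ray hρ))

theorem norm_mult_le (h : AdmissibleAngle β x₀ θ c) (x : ℝ) {ρ : ℝ} (hρ : 0 < ρ) :
    ‖mult β x₀ x (ρ * dir θ)‖ ≤ |β| / c / (1 + ρ) := by
  unfold mult
  rw [norm_div, norm_mul, Complex.norm_real, Real.norm_eq_abs, div_div]
  exact div_le_div₀ (abs_nonneg _)
    (mul_le_of_le_one_right (abs_nonneg _) (norm_kern_le_one x (h.re_pos hρ).le 0))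
    (mul_pos h.pos (by linarith)) (h.le_norm_ray hρ.le)

theorem norm_mult_le_const (h : AdmissibleAngle β x₀ θ c) (x : ℝ) {ρ : ℝ} (hρ : 0 < ρ) :
    ‖mult β x₀ x (ρ * dir θ)‖ ≤ |β| / c :=
  (h.norm_mult_le x hρ).trans (div_le_self (div_nonneg (abs_nonneg _) h.pos.le) (by linarith))

theorem measurable_mult (β x₀ θ x : ℝ) : Measurable fun ρ : ℝ => mult β x₀ x (ρ * dir θ) := by
  have h1 := (continuous_charFn β x₀).measurable
  unfold mult kern
  fun_prop

theorem norm_resPair_le (h : AdmissibleAngle β x₀ θ c) {f : ℝ → ℝ} {x ρ B : ℝ} (hρ : 0 < ρ)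
    (hB : ∀ a, ‖lap f a (ρ * dir θ)‖ ≤ B) :
    ‖resPair β x₀ f x (ρ * dir θ)‖ ≤ (1 + |β| / c) * B := by
  unfold resPair
  refine (norm_sub_le _ _).trans ?_
  rw [norm_mul]
  have h2 := mul_le_mul (h.norm_mult_le_const x hρ) (hB x₀) (norm_nonneg _)
    (div_nonneg (abs_nonneg _) h.pos.le)
  have := hB x
  linarith

theorem one_div_sqrt_re (h : AdmissibleAngle β x₀ θ c) {ρ : ℝ} (hρ : 0 < ρ) :
    1 / √((ρ : ℂ) * dir θ).re = 1 / √(Real.cos θ) * ρ ^ (-(1 / 2) : ℝ) := by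
  rw [re_mul_dir, Real.sqrt_mul hρ.le, Real.rpow_neg hρ.le, ← Real.sqrt_eq_rpow]
  have := h.cos_pos
  field_simp

theorem norm_lap_le_rpow (h : AdmissibleAngle β x₀ θ c) (v : H1) (a : ℝ) {ρ : ℝ} (hρ : 0 < ρ) :
    ‖lap (H1.rep v) a (ρ * dir θ)‖ ≤
      2 * ‖v‖ * (1 / √(Real.cos θ)) * ρ ^ (-(1 / 2) : ℝ) := by
  rw [mul_assoc, ← h.one_div_sqrt_re hρ]
  exact norm_lap_le_L2 v a _ (h.re_pos hρ)

theorem norm_lap_le_dual_rpow (h : AdmissibleAngle β x₀ θ c) (v : H1) (a : ℝ) {ρ : ℝ}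
    (hρ : 0 < ρ) :
    ‖lap (H1.rep v) a (ρ * dir θ)‖ ≤
      2 * ‖embed v‖ * (1 / √(Real.cos θ)) * (ρ ^ (-(1 / 2) : ℝ) + ρ ^ (1 / 2 : ℝ)) := by
  refine (norm_lap_le_dual v a _ (h.re_pos hρ)).trans (le_of_eq ?_)
  have e : ρ ^ (1 / 2 : ℝ) = ρ * ρ ^ (-(1 / 2) : ℝ) := by
    rw [← Real.rpow_one_add' hρ.le (by norm_num)]; norm_num
  rw [div_eq_mul_one_div, h.one_div_sqrt_re hρ, norm_mul_dir hρ.le, e]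
  ring

theorem aestronglyMeasurable_resPair {f : ℝ → ℝ} (hf : AEStronglyMeasurable f volume)
    (x : ℝ) {μ : Measure ℝ} [SFinite μ] :
    AEStronglyMeasurable (fun ρ : ℝ => resPair β x₀ f x (ρ * dir θ)) μ :=
  (aestronglyMeasurable_lap hf x θ).sub
    ((measurable_mult β x₀ θ x).aestronglyMeasurable.mul (aestronglyMeasurable_lap hf x₀ θ))

theorem continuous_exp_sq (θ τ : ℝ) :
    Continuous fun ρ : ℝ => Complex.exp (((ρ : ℂ) * dir θ) ^ 2 * τ) := by fun_prop

/-- Integrability of the representation integrand attached to an element of `H¹(ℝ)`. -/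
theorem integrableOn_exp_mul_resPair (h : AdmissibleAngle β x₀ θ c) (v : H1) (x : ℝ) {τ : ℝ}
    (hτ : 0 < τ) :
    IntegrableOn (fun ρ : ℝ => Complex.exp (((ρ : ℂ) * dir θ) ^ 2 * τ) *
      resPair β x₀ (H1.rep v) x (ρ * dir θ)) (Set.Ioi 0) := by
  have hb : 0 < τ * -Real.cos (2 * θ) := mul_pos hτ h.neg_cos_pos
  refine ((integrableOn_rpow_mul_exp_neg_mul_sq hb
    (s := -(1 / 2)) (by norm_num)).const_mul
    ((1 + |β| / c) * (2 * ‖v‖ * (1 / √(Real.cos θ))))).mono'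
    ((continuous_exp_sq θ τ).aestronglyMeasurable.mul
      (aestronglyMeasurable_resPair (H1.continuous_rep v).aestronglyMeasurable x)) ?_
  filter_upwards [ae_restrict_mem measurableSet_Ioi] with ρ hρ
  rw [norm_mul, norm_exp_sq_mul_dir, ← neg_mul]
  have h1 := h.norm_resPair_le (x := x) hρ (fun a => h.norm_lap_le_rpow v a hρ)
  calc _ ≤ Real.exp (-(τ * -Real.cos (2 * θ)) * ρ ^ 2) *
        ((1 + |β| / c) * (2 * ‖v‖ * (1 / √(Real.cos θ)) * ρ ^ (-(1 / 2) : ℝ))) := by gcongr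
    _ = _ := by ring

end AdmissibleAngle

/-! ### The conserved quantity -/

/-- The imaginary part of the integral of `e^{z² τ}` times the resolvent pairing of `f` along a
ray. -/
def evolve (β x₀ θ x τ : ℝ) (f : ℝ → ℝ) : ℝ :=
  (rayInt θ fun z => Complex.exp (z ^ 2 * τ) * resPair β x₀ f x z).im

namespace IsSolution

variable {β x₀ θ c : ℝ} {U₀ : HNeg1} {u : ℝ → H1}

theorem continuousOn_rep (hu : IsSolution β x₀ U₀ u) (x : ℝ) :
    ContinuousOn (fun t => H1.rep (u t) x) (Set.Ioi 0) :=
  (dirac x).continuous.comp_continuousOn hu.continuousOn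

/-- The difference of the two ray integrals is a double integral of -2z e^{z²(T - s)} u(s, x). After
Fubini the ray integral is explicit and real, so nothing is left in the imaginary part. -/
theorem evolve_eq_evolve (hu : IsSolution β x₀ U₀ u) (h : AdmissibleAngle β x₀ θ c)
    (hx₀ : 0 ≤ x₀) (x : ℝ) {t₁ t₂ T : ℝ} (h1 : 0 < t₁) (h12 : t₁ ≤ t₂) (h2 : t₂ < T) :
    evolve β x₀ θ x (T - t₁) (H1.rep (u t₁)) = evolve β x₀ θ x (T - t₂) (H1.rep (u t₂)) := by
  set y : ℝ → ℝ := fun t => H1.rep (u t) x with hy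
  have hsub : Set.Icc t₁ t₂ ⊆ Set.Ioi 0 := fun s hs => lt_of_lt_of_le h1 hs.1
  have hyc : ContinuousOn y (Set.Icc t₁ t₂) := (hu.continuousOn_rep x).mono hsub
  set K : ℝ → ℝ → ℂ := fun ρ s =>
    2 * (ρ * dir θ) * Complex.exp (((ρ : ℂ) * dir θ) ^ 2 * (T - s : ℝ)) * dir θ * (-(y s : ℂ))
    with hK
  have ftc : ∀ ρ : ℝ, 0 < ρ →
      Complex.exp (((ρ : ℂ) * dir θ) ^ 2 * (T - t₂ : ℝ)) *
          resPair β x₀ (H1.rep (u t₂)) x (ρ * dir θ) * dir θ -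
        Complex.exp (((ρ : ℂ) * dir θ) ^ 2 * (T - t₁ : ℝ)) *
          resPair β x₀ (H1.rep (u t₁)) x (ρ * dir θ) * dir θ =
      ∫ s in Set.Ioc t₁ t₂, K ρ s := by
    intro ρ hρ
    rw [← intervalIntegral.integral_of_le h12]
    symm
    apply intervalIntegral.integral_eq_sub_of_hasDerivAt (f := fun s =>
      Complex.exp (((ρ : ℂ) * dir θ) ^ 2 * (T - s : ℝ)) *
          resPair β x₀ (H1.rep (u s)) x (ρ * dir θ) * dir θ)
    · intro s hs
      rw [Set.uIcc_of_le h12] at hs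
      have hs0 : 0 < s := hsub hs
      have e1 : HasDerivAt (fun s : ℝ => ((T - s : ℝ) : ℂ)) (-1) s := by
        simpa using ((hasDerivAt_id s).const_sub T).ofReal_comp
      have e2 := (e1.const_mul (((ρ : ℂ) * dir θ) ^ 2)).cexp
      have e3 := hu.hasDerivAt_resPair hx₀ x _ (h.re_pos hρ) (h.charFn_ne_zero hρ.le) hs0
      refine ((e2.mul e3).mul_const (dir θ)).congr_deriv ?_
      simp only [hK, hy]
      ring
    · apply ContinuousOn.intervalIntegrable
      rw [Set.uIcc_of_le h12]
      have : ContinuousOn (fun s => -(y s : ℂ)) (Set.Icc t₁ t₂) :=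
        (Complex.continuous_ofReal.comp_continuousOn hyc).neg
      exact ContinuousOn.mul (by fun_prop) this
  have hdiff : (rayInt θ fun z => Complex.exp (z ^ 2 * (T - t₂ : ℝ)) *
        resPair β x₀ (H1.rep (u t₂)) x z) -
      (rayInt θ fun z => Complex.exp (z ^ 2 * (T - t₁ : ℝ)) *
        resPair β x₀ (H1.rep (u t₁)) x z) =
      ∫ ρ in Set.Ioi (0 : ℝ), ∫ s in Set.Ioc t₁ t₂, K ρ s := by
    unfold rayInt
    rw [← integral_sub]
    · exact setIntegral_congr_fun measurableSet_Ioi fun ρ hρ => ftc ρ hρ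
    · exact (h.integrableOn_exp_mul_resPair (u t₂) x (by linarith)).mul_const _
    · exact (h.integrableOn_exp_mul_resPair (u t₁) x (by linarith)).mul_const _
  obtain ⟨M, hM⟩ := isCompact_Icc.exists_bound_of_continuousOn hyc
  -- The slowest Gaussian rate on [t₁, t₂] is the one at s = t₂, still positive because t₂ < T.
  have hb : 0 < (T - t₂) * -Real.cos (2 * θ) := mul_pos (by linarith) h.neg_cos_pos
  have hint : Integrable (Function.uncurry K)
      ((volume.restrict (Set.Ioi 0)).prod (volume.restrict (Set.Ioc t₁ t₂))) := by
    have hg : IntegrableOn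
        (fun ρ : ℝ => 2 * ρ * Real.exp (-((T - t₂) * -Real.cos (2 * θ)) * ρ ^ 2) * M)
        (Set.Ioi 0) := by
      have := ((integrable_mul_exp_neg_mul_sq hb).const_mul 2).mul_const M
      simp only [← mul_assoc] at this
      exact this.integrableOn
    refine (hg.mul_prod (ν := volume.restrict (Set.Ioc t₁ t₂)) (g := fun _ => (1 : ℝ))
      (integrable_const 1)).mono' ?_ ?_
    · have m1 : AEStronglyMeasurable (fun s => -(y s : ℂ)) (volume.restrict (Set.Ioc t₁ t₂)) :=
        ((Complex.continuous_ofReal.comp_continuousOn hyc).neg.mono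
          Set.Ioc_subset_Icc_self).aestronglyMeasurable measurableSet_Ioc
      have m2 : Continuous fun p : ℝ × ℝ => 2 * ((p.1 : ℂ) * dir θ) *
          Complex.exp (((p.1 : ℂ) * dir θ) ^ 2 * (T - p.2 : ℝ)) * dir θ := by fun_prop
      exact m2.aestronglyMeasurable.mul m1.comp_snd
    · rw [Measure.prod_restrict]
      filter_upwards [ae_restrict_mem (measurableSet_Ioi.prod measurableSet_Ioc)] with p hp
      obtain ⟨hρ, hs⟩ := hp
      simp only [Function.uncurry, hK, mul_one]
      have hρ0 : (0 : ℝ) < p.1 := hρ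
      rw [norm_mul, norm_mul, norm_mul, norm_mul, norm_mul_dir hρ0.le, norm_exp_sq_mul_dir,
        norm_dir, norm_neg, Complex.norm_real, mul_one, Complex.norm_two]
      have h3 := hM p.2 ⟨hs.1.le, hs.2⟩
      have h4 : Real.exp (-((T - p.2) * -Real.cos (2 * θ) * p.1 ^ 2)) ≤
          Real.exp (-((T - t₂) * -Real.cos (2 * θ)) * p.1 ^ 2) := by
        apply Real.exp_le_exp.2
        rw [neg_mul, neg_le_neg_iff]
        have := h.neg_cos_pos
        have := hs.2
        gcongr
      have h5 : 0 ≤ M := (norm_nonneg _).trans h3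
      gcongr
  rw [integral_integral_swap hint] at hdiff
  have hinner : ∀ s ∈ Set.Ioc t₁ t₂, ∫ ρ in Set.Ioi (0 : ℝ), K ρ s =
      (((T - s)⁻¹ * y s : ℝ) : ℂ) := by
    intro s hs
    have := rayInt_two_mul_exp h.lt_angle h.angle_lt (τ := T - s) (by linarith [hs.2])
    simp only [hK]
    rw [integral_mul_const]
    unfold rayInt at this
    rw [this]
    push_cast; ring
  rw [setIntegral_congr_fun measurableSet_Ioc hinner, integral_complex_ofReal] at hdiff
  have := congrArg Complex.im hdiff
  rw [Complex.sub_im, Complex.ofReal_im] at this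
  unfold evolve
  linarith

/-- The limit of the conserved quantity at the initial time. -/
theorem tendsto_evolve_zero {u₀ : ℝ → ℝ} {hu₀ : Integrable u₀}
    (hu : IsSolution β x₀ (ofL1 u₀ hu₀) u) (h : AdmissibleAngle β x₀ θ c) (x : ℝ) {T : ℝ}
    (hT : 0 < T) :
    Tendsto (fun t => evolve β x₀ θ x (T - t) (H1.rep (u t))) (𝓝[>] 0)
      (𝓝 (evolve β x₀ θ x T u₀)) := by
  unfold evolve
  refine (Complex.continuous_im.tendsto _).comp ?_
  unfold rayInt
  have hlap : ∀ a z, 0 < z.re → Tendsto (fun t => lap (H1.rep (u t)) a z) (𝓝[>] 0)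
      (𝓝 (lap u₀ a z)) := by
    intro a z hz
    have hc : ∀ e : ℂ, Tendsto (fun t => ((embed (u t) (kernH1 a z hz e) : ℝ) : ℂ)) (𝓝[>] 0)
        (𝓝 ((ofL1 u₀ hu₀ (kernH1 a z hz e) : ℝ) : ℂ)) := fun e =>
      (Complex.continuous_ofReal.tendsto _).comp
        (((ContinuousLinearMap.apply ℝ ℝ (kernH1 a z hz e)).continuous.tendsto _).comp hu.initial)
    rw [lap_eq_ofL1 u₀ hu₀ a z hz]
    refine ((hc 1).add ((hc (-Complex.I)).mul_const Complex.I)).congr fun t => ?_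
    rw [lap_rep_eq]
  set M : ℝ := ‖ofL1 u₀ hu₀‖ + 1 with hM
  have hbd : ∀ᶠ t in 𝓝[>] (0 : ℝ), ‖embed (u t)‖ ≤ M := by
    have h1 : Tendsto (fun t => ‖embed (u t)‖) (𝓝[>] 0) (𝓝 ‖ofL1 u₀ hu₀‖) :=
      (continuous_norm (E := HNeg1)).continuousAt.tendsto.comp hu.initial
    filter_upwards [h1.eventually_lt_const (lt_add_one _)] with t ht using ht.le
  have hsmall : ∀ᶠ t in 𝓝[>] (0 : ℝ), t < T / 2 :=
    nhdsWithin_le_nhds (Iio_mem_nhds (by linarith))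
  -- Restricting to t < T/2 keeps the Gaussian rate away from zero, uniformly as t → 0.
  have hb : 0 < T / 2 * -Real.cos (2 * θ) := mul_pos (by linarith) h.neg_cos_pos
  have hg := ((integrableOn_rpow_mul_exp_neg_mul_sq hb (s := -(1 / 2)) (by norm_num)).add
    (integrableOn_rpow_mul_exp_neg_mul_sq hb (s := 1 / 2) (by norm_num))).const_mul
    ((1 + |β| / c) * (2 * M * (1 / √(Real.cos θ))))
  refine tendsto_integral_filter_of_dominated_convergence _ ?_ ?_ hg ?_
  · exact Eventually.of_forall fun t =>
      ((AdmissibleAngle.continuous_exp_sq θ _).aestronglyMeasurable.mul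
        (AdmissibleAngle.aestronglyMeasurable_resPair
          (H1.continuous_rep (u t)).aestronglyMeasurable x)).mul_const _
  · filter_upwards [hbd, hsmall] with t ht1 ht2
    filter_upwards [ae_restrict_mem measurableSet_Ioi] with ρ hρ
    have hρ0 : (0 : ℝ) < ρ := hρ
    rw [norm_mul, norm_dir, mul_one, norm_mul, norm_exp_sq_mul_dir]
    have h1 := h.norm_resPair_le (x := x) hρ0 (fun a => h.norm_lap_le_dual_rpow (u t) a hρ0)
    have h4 : Real.exp (-((T - t) * -Real.cos (2 * θ) * ρ ^ 2)) ≤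
        Real.exp (-(T / 2 * -Real.cos (2 * θ)) * ρ ^ 2) := by
      apply Real.exp_le_exp.2
      rw [neg_mul, neg_le_neg_iff]
      have := h.neg_cos_pos
      gcongr
      linarith
    have h5 : 0 ≤ |β| / c := div_nonneg (abs_nonneg _) h.pos.le
    have h6 : 0 ≤ ρ ^ (-(1 / 2) : ℝ) + ρ ^ (1 / 2 : ℝ) := by positivity
    calc _ ≤ Real.exp (-(T / 2 * -Real.cos (2 * θ)) * ρ ^ 2) * ((1 + |β| / c) *
          (2 * M * (1 / √(Real.cos θ)) * (ρ ^ (-(1 / 2) : ℝ) + ρ ^ (1 / 2 : ℝ)))) := by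
          gcongr
          refine h1.trans ?_
          gcongr
      _ = _ := by simp only [Pi.add_apply]; ring
  · filter_upwards [ae_restrict_mem measurableSet_Ioi] with ρ hρ
    refine Tendsto.mul_const _ (Tendsto.mul ?_ ?_)
    · have hcont : Continuous fun t : ℝ =>
          Complex.exp (((ρ : ℂ) * dir θ) ^ 2 * (T - t : ℝ)) := by fun_prop
      have := hcont.tendsto 0
      rw [sub_zero] at this
      exact this.mono_left nhdsWithin_le_nhds
    · exact (hlap x _ (h.re_pos hρ)).sub ((hlap x₀ _ (h.re_pos hρ)).const_mul _)

end IsSolution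

/-! ### The limit at the final time -/

/-- Young's inequality with weight s = √(Re z): |v| E ≤ v²/(2s) + s E²/2, where E = e^{-|ξ - a| Re
z} and ∫ E² = 1/s². It gives the absolute integrability needed for Fubini, with the same power of Re
z as Cauchy-Schwarz. -/
theorem integral_norm_rep_mul_kern_le (v : H1) (a : ℝ) {z : ℂ} (hz : 0 < z.re) :
    ∫ ξ, ‖(H1.rep v ξ : ℂ) * kern a z ξ‖ ≤
      ((∫ ξ, H1.rep v ξ * H1.rep v ξ) + 1) / 2 * (1 / √z.re) := by
  have hs : 0 < √z.re := Real.sqrt_pos.2 hz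
  have hsq : √z.re * √z.re = z.re := Real.mul_self_sqrt hz.le
  have hv := H1.integrable_rep_mul_rep v v
  have he := integrable_exp_neg_abs (b := 2 * z.re) (by linarith) a
  have hle : ∫ ξ, ‖(H1.rep v ξ : ℂ) * kern a z ξ‖ ≤
      ∫ ξ, (1 / (2 * √z.re) * (H1.rep v ξ * H1.rep v ξ) +
        √z.re / 2 * Real.exp (-(|ξ - a| * (2 * z.re)))) := by
    apply integral_mono (integrable_rep_mul_kern v a hz).norm
      ((hv.const_mul _).add (he.const_mul _))
    intro ξ
    simp only [Pi.add_apply]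
    rw [norm_mul, norm_kern, Complex.norm_real, Real.norm_eq_abs]
    have e1 : Real.exp (-(|ξ - a| * (2 * z.re))) =
        Real.exp (-(|ξ - a| * z.re)) * Real.exp (-(|ξ - a| * z.re)) := by
      rw [← Real.exp_add]; congr 1; ring
    rw [e1, ← abs_mul_abs_self (H1.rep v ξ)]
    set A := |H1.rep v ξ|
    set E := Real.exp (-(|ξ - a| * z.re))
    have key : 0 ≤ (A - √z.re * E) ^ 2 / (2 * √z.re) := by positivity
    have e2 : (A - √z.re * E) ^ 2 / (2 * √z.re) =
        1 / (2 * √z.re) * (A * A) + √z.re / 2 * (E * E) - A * E := by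
      field_simp
      ring
    linarith
  refine hle.trans (le_of_eq ?_)
  rw [integral_add (hv.const_mul _) (he.const_mul _), integral_const_mul, integral_const_mul,
    integral_exp_neg_abs (by linarith)]
  have : √z.re / 2 * (2 / (2 * z.re)) = 1 / (2 * √z.re) := by
    rw [← hsq, Real.sqrt_mul_self hs.le]
    field_simp
  rw [this]
  field_simp

/-- Fubini's theorem for the pairing with exponential kernels along a ray. -/
theorem AdmissibleAngle.im_integral_mul_lap {β x₀ θ c : ℝ} (h : AdmissibleAngle β x₀ θ c) (v : H1)
    (a : ℝ) {k : ℝ → ℂ} (hk : AEStronglyMeasurable k (volume.restrict (Set.Ioi 0)))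
    (hki : IntegrableOn (fun ρ : ℝ => ‖k ρ‖ * ρ ^ (-(1 / 2) : ℝ)) (Set.Ioi 0)) :
    (∫ ρ in Set.Ioi (0 : ℝ), k ρ * lap (H1.rep v) a (ρ * dir θ)).im =
      ∫ ξ, H1.rep v ξ * (∫ ρ in Set.Ioi (0 : ℝ), k ρ * kern a (ρ * dir θ) ξ).im := by
  set f : ℝ → ℝ → ℂ := fun ρ ξ => k ρ * ((H1.rep v ξ : ℂ) * kern a (ρ * dir θ) ξ) with hf
  have hmeas : AEStronglyMeasurable (Function.uncurry f)
      ((volume.restrict (Set.Ioi 0)).prod volume) := by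
    have h1 : Continuous fun p : ℝ × ℝ => (H1.rep v p.2 : ℂ) * kern a (p.1 * dir θ) p.2 := by
      have := H1.continuous_rep v
      unfold kern
      fun_prop
    exact hk.comp_fst.mul h1.aestronglyMeasurable
  have hint : Integrable (Function.uncurry f)
      ((volume.restrict (Set.Ioi 0)).prod volume) := by
    rw [integrable_prod_iff hmeas]
    constructor
    · filter_upwards [ae_restrict_mem measurableSet_Ioi] with ρ hρ
      exact (integrable_rep_mul_kern v a (h.re_pos hρ)).const_mul (k ρ)
    · refine (hki.const_mul
        (((∫ ξ, H1.rep v ξ * H1.rep v ξ) + 1) / 2 * (1 / √(Real.cos θ)))).mono'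
        hmeas.norm.integral_prod_right' ?_
      filter_upwards [ae_restrict_mem measurableSet_Ioi] with ρ hρ
      have h1 := integral_norm_rep_mul_kern_le v a (h.re_pos hρ)
      rw [h.one_div_sqrt_re hρ] at h1
      rw [Real.norm_of_nonneg (integral_nonneg fun _ => norm_nonneg _)]
      simp only [Function.uncurry, hf, norm_mul (k ρ)]
      rw [integral_const_mul]
      calc _ ≤ ‖k ρ‖ * _ := mul_le_mul_of_nonneg_left h1 (norm_nonneg _)
        _ = _ := by ring
  have e1 : ∫ ρ in Set.Ioi (0 : ℝ), k ρ * lap (H1.rep v) a (ρ * dir θ) =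
      ∫ ξ, ∫ ρ in Set.Ioi (0 : ℝ), f ρ ξ := by
    rw [← integral_integral_swap hint]
    simp only [hf, lap, integral_const_mul]
  rw [e1]
  refine (integral_im hint.integral_prod_right).symm.trans ?_
  refine integral_congr_ae (Eventually.of_forall fun ξ => ?_)
  simp only [Function.uncurry]
  change (∫ ρ in Set.Ioi (0 : ℝ), f ρ ξ).im = _
  rw [← Complex.im_ofReal_mul, ← integral_const_mul]
  simp only [hf, mul_left_comm]

/-- The scaling ξ = x + √τ r moves τ from the concentrating Gaussian into the argument of v, so that
the limit τ → 0 becomes a case of dominated convergence. -/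
theorem integral_rep_mul_gaussian (v : H1) (x : ℝ) {τ : ℝ} (hτ : 0 < τ) :
    ∫ ξ, H1.rep v ξ * (√(Real.pi / τ) / 2 * Real.exp (-(|ξ - x| ^ 2 / (4 * τ)))) =
      ∫ r, H1.rep v (x + √τ * r) * (√Real.pi / 2 * Real.exp (-(1 / 4) * r ^ 2)) := by
  have hs : 0 < √τ := Real.sqrt_pos.2 hτ
  have hsq : √τ ^ 2 = τ := Real.sq_sqrt hτ.le
  rw [← integral_add_left_eq_self _ x]
  have h := Measure.integral_comp_mul_left (fun ξ => H1.rep v (x + ξ) *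
    (√(Real.pi / τ) / 2 * Real.exp (-(|x + ξ - x| ^ 2 / (4 * τ))))) (√τ)
  rw [abs_of_pos (inv_pos.2 hs), smul_eq_mul, eq_comm, inv_mul_eq_iff_eq_mul₀ hs.ne'] at h
  rw [h, ← integral_const_mul]
  refine integral_congr_ae (Eventually.of_forall fun r => ?_)
  simp only
  rw [add_sub_cancel_left, sq_abs, mul_pow, Real.sqrt_div Real.pi_pos.le, hsq,
    show -(τ * r ^ 2 / (4 * τ)) = -(1 / 4) * r ^ 2 by field_simp]
  field_simp

namespace IsSolution

variable {β x₀ θ c : ℝ} {U₀ : HNeg1} {u : ℝ → H1}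

theorem tendsto_left (hu : IsSolution β x₀ U₀ u) {T : ℝ} (hT : 0 < T) :
    Tendsto u (𝓝[<] T) (𝓝 (u T)) :=
  ((hu.continuousOn.continuousAt (Ioi_mem_nhds hT)).tendsto).mono_left nhdsWithin_le_nhds

/-- The weight has total mass π. Continuity in H¹ gives uniform convergence of the representatives,
which handles the simultaneous motion of u(t) and of the evaluation point. -/
theorem tendsto_integral_gaussian (hu : IsSolution β x₀ U₀ u) (x : ℝ) {T : ℝ} (hT : 0 < T) :
    Tendsto (fun t => ∫ r, H1.rep (u t) (x + √(T - t) * r) *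
      (√Real.pi / 2 * Real.exp (-(1 / 4) * r ^ 2))) (𝓝[<] T) (𝓝 (Real.pi * H1.rep (u T) x)) := by
  have hg : Integrable fun r : ℝ => √Real.pi / 2 * Real.exp (-(1 / 4) * r ^ 2) :=
    (integrable_exp_neg_mul_sq (by norm_num)).const_mul _
  have hval : Real.pi * H1.rep (u T) x =
      ∫ r : ℝ, H1.rep (u T) x * (√Real.pi / 2 * Real.exp (-(1 / 4) * r ^ 2)) := by
    rw [integral_const_mul, integral_const_mul, integral_gaussian]
    have e : √(Real.pi / (1 / 4)) = √Real.pi * 2 := by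
      rw [div_div_eq_mul_div, div_one, Real.sqrt_mul Real.pi_pos.le,
        show (4 : ℝ) = 2 ^ 2 by norm_num, Real.sqrt_sq (by norm_num)]
    have hp := Real.mul_self_sqrt Real.pi_pos.le
    rw [e]
    linear_combination (-H1.rep (u T) x) * hp
  rw [hval]
  have hlim := hu.tendsto_left hT
  have hbd : ∀ᶠ t in 𝓝[<] T, ‖u t‖ ≤ ‖u T‖ + 1 := by
    filter_upwards [hlim.norm.eventually_lt_const (lt_add_one _)] with t ht using ht.le
  refine tendsto_integral_filter_of_dominated_convergence
    (fun r => 2 * (‖u T‖ + 1) * (√Real.pi / 2 * Real.exp (-(1 / 4) * r ^ 2))) ?_ ?_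
    (hg.const_mul _) ?_
  · refine Eventually.of_forall fun t => Continuous.aestronglyMeasurable ?_
    have := H1.continuous_rep (u t)
    fun_prop
  · filter_upwards [hbd] with t ht
    refine Eventually.of_forall fun r => ?_
    rw [norm_mul, Real.norm_of_nonneg (by positivity :
      0 ≤ √Real.pi / 2 * Real.exp (-(1 / 4) * r ^ 2))]
    have := H1.abs_rep_le (u t) (x + √(T - t) * r)
    refine mul_le_mul_of_nonneg_right ?_ (by positivity)
    rw [Real.norm_eq_abs]
    linarith
  · refine Eventually.of_forall fun r => Tendsto.mul_const _ ?_
    have h1 : Tendsto (fun t => H1.rep (u T) (x + √(T - t) * r)) (𝓝[<] T)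
        (𝓝 (H1.rep (u T) x)) := by
      have hc : Continuous fun t => H1.rep (u T) (x + √(T - t) * r) := by
        have := H1.continuous_rep (u T)
        fun_prop
      have := hc.tendsto T
      simp only [sub_self, Real.sqrt_zero, zero_mul, add_zero] at this
      exact this.mono_left nhdsWithin_le_nhds
    have h2 : Tendsto (fun t => H1.rep (u t) (x + √(T - t) * r) -
        H1.rep (u T) (x + √(T - t) * r)) (𝓝[<] T) (𝓝 0) := by
      have hn : Tendsto (fun t => 2 * ‖u t - u T‖) (𝓝[<] T) (𝓝 0) := by
        have := (hlim.sub_const (u T)).norm.const_mul 2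
        simpa using this
      refine squeeze_zero_norm (fun t => ?_) hn
      have := H1.abs_rep_le (u t - u T) (x + √(T - t) * r)
      rwa [← dirac_apply, map_sub, dirac_apply, dirac_apply] at this
    simpa using h2.add h1

theorem tendsto_lap (hu : IsSolution β x₀ U₀ u) (a : ℝ) {z : ℂ} (hz : 0 < z.re) {T : ℝ}
    (hT : 0 < T) :
    Tendsto (fun t => lap (H1.rep (u t)) a z) (𝓝[<] T) (𝓝 (lap (H1.rep (u T)) a z)) :=
  ((hu.hasDerivAt_lap a z hz hT).continuousAt.tendsto).mono_left nhdsWithin_le_nhds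

/-- After Fubini the integrand for each ξ is a real multiple of e^{-Az} / D(z) with A = |x| + |ξ -
x₀|, whose ray integral is real. -/
theorem im_integral_mult_mul_lap (h : AdmissibleAngle β x₀ θ c) (v : H1) (x : ℝ) :
    (∫ ρ in Set.Ioi (0 : ℝ), mult β x₀ x (ρ * dir θ) * dir θ *
      lap (H1.rep v) x₀ (ρ * dir θ)).im = 0 := by
  have hmeas : AEStronglyMeasurable (fun ρ : ℝ => mult β x₀ x (ρ * dir θ) * dir θ)
      (volume.restrict (Set.Ioi 0)) :=
    ((AdmissibleAngle.measurable_mult β x₀ θ x).mul_const _).aestronglyMeasurable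
  rw [h.im_integral_mul_lap v x₀ hmeas]
  · apply integral_eq_zero_of_ae
    -- Discarding ξ = x₀ ensures A > 0, even when x = 0.
    have hne : ∀ᵐ ξ : ℝ, ξ ≠ x₀ := by
      rw [ae_iff]; simp
    filter_upwards [hne] with ξ hξ
    have hA : 0 < |x| + |ξ - x₀| := by
      have := abs_pos.2 (sub_ne_zero.2 hξ)
      positivity
    have key := im_rayInt_exp_div_charFn h.nonneg h.angle_lt h.pos h.le_norm hA
    have e : (∫ ρ in Set.Ioi (0 : ℝ), mult β x₀ x (ρ * dir θ) * dir θ *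
        kern x₀ (ρ * dir θ) ξ) =
        (β : ℂ) * rayInt θ fun z =>
          Complex.exp (-(((|x| + |ξ - x₀| : ℝ) : ℂ) * z)) / charFn β x₀ z := by
      rw [rayInt, ← integral_const_mul]
      refine setIntegral_congr_fun measurableSet_Ioi fun ρ _ => ?_
      simp only [mult, kern, zero_sub, abs_neg]
      rw [Complex.ofReal_add, add_mul, neg_add, Complex.exp_add]
      ring
    rw [e, Complex.im_ofReal_mul, key, mul_zero, mul_zero, Pi.zero_apply]
  · refine (integrableOn_rpow_neg_half_div.const_mul (|β| / c)).mono'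
      (hmeas.norm.mul (by fun_prop : Measurable fun ρ : ℝ =>
        ρ ^ (-(1 / 2) : ℝ)).aestronglyMeasurable) ?_
    filter_upwards [ae_restrict_mem measurableSet_Ioi] with ρ hρ
    have hρ0 : (0 : ℝ) < ρ := hρ
    rw [norm_mul, norm_norm, norm_mul, norm_dir, mul_one,
      Real.norm_of_nonneg (Real.rpow_nonneg hρ0.le _)]
    calc _ ≤ |β| / c / (1 + ρ) * ρ ^ (-(1 / 2) : ℝ) := by
          gcongr
          exact h.norm_mult_le x hρ0
      _ = _ := by ring

theorem tendsto_integral_mult (hu : IsSolution β x₀ U₀ u) (h : AdmissibleAngle β x₀ θ c) (x : ℝ)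
    {T : ℝ} (hT : 0 < T) :
    Tendsto (fun t => (∫ ρ in Set.Ioi (0 : ℝ),
      Complex.exp (((ρ : ℂ) * dir θ) ^ 2 * (T - t : ℝ)) * (mult β x₀ x (ρ * dir θ) * dir θ *
        lap (H1.rep (u t)) x₀ (ρ * dir θ))).im) (𝓝[<] T) (𝓝 0) := by
  suffices hL : Tendsto (fun t => ∫ ρ in Set.Ioi (0 : ℝ),
      Complex.exp (((ρ : ℂ) * dir θ) ^ 2 * (T - t : ℝ)) * (mult β x₀ x (ρ * dir θ) * dir θ *
        lap (H1.rep (u t)) x₀ (ρ * dir θ))) (𝓝[<] T)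
      (𝓝 (∫ ρ in Set.Ioi (0 : ℝ), mult β x₀ x (ρ * dir θ) * dir θ *
        lap (H1.rep (u T)) x₀ (ρ * dir θ))) by
    have := (Complex.continuous_im.tendsto _).comp hL
    rwa [im_integral_mult_mul_lap h] at this
  have hlim := hu.tendsto_left hT
  have hbd : ∀ᶠ t in 𝓝[<] T, ‖u t‖ ≤ ‖u T‖ + 1 := by
    filter_upwards [hlim.norm.eventually_lt_const (lt_add_one _)] with t ht using ht.le
  refine tendsto_integral_filter_of_dominated_convergence _ ?_ ?_
    (integrableOn_rpow_neg_half_div.const_mul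
      (|β| / c * (2 * (‖u T‖ + 1) * (1 / √(Real.cos θ))))) ?_
  · exact Eventually.of_forall fun t =>
      (AdmissibleAngle.continuous_exp_sq θ _).aestronglyMeasurable.mul
        (((AdmissibleAngle.measurable_mult β x₀ θ x).mul_const _).aestronglyMeasurable.mul
          (aestronglyMeasurable_lap (H1.continuous_rep (u t)).aestronglyMeasurable x₀ θ))
  · filter_upwards [hbd, self_mem_nhdsWithin] with t ht htT
    filter_upwards [ae_restrict_mem measurableSet_Ioi] with ρ hρ
    have hρ0 : (0 : ℝ) < ρ := hρ
    have hτ : 0 ≤ T - t := by linarith [show t < T from htT]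
    rw [norm_mul, norm_exp_sq_mul_dir, norm_mul, norm_mul, norm_dir, mul_one]
    have h1 : Real.exp (-((T - t) * -Real.cos (2 * θ) * ρ ^ 2)) ≤ 1 := by
      apply Real.exp_le_one_iff.2
      have := h.neg_cos_pos
      have : 0 ≤ (T - t) * -Real.cos (2 * θ) * ρ ^ 2 := by positivity
      linarith
    have h2 := h.norm_mult_le x hρ0
    have h3 := h.norm_lap_le_rpow (u t) x₀ hρ0
    have h4 : 0 ≤ |β| / c := div_nonneg (abs_nonneg _) h.pos.le
    have h5 : 0 ≤ ρ ^ (-(1 / 2) : ℝ) := Real.rpow_nonneg hρ0.le _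
    calc _ ≤ 1 * (|β| / c / (1 + ρ) *
          (2 * (‖u T‖ + 1) * (1 / √(Real.cos θ)) * ρ ^ (-(1 / 2) : ℝ))) := by
          gcongr
          refine h3.trans ?_
          gcongr
      _ = _ := by ring
  · filter_upwards [ae_restrict_mem measurableSet_Ioi] with ρ hρ
    have hcont : Continuous fun t : ℝ =>
        Complex.exp (((ρ : ℂ) * dir θ) ^ 2 * (T - t : ℝ)) := by fun_prop
    have h1 := (hcont.tendsto T).mono_left (nhdsWithin_le_nhds (s := Set.Iio T))
    simp only [sub_self, Complex.ofReal_zero, mul_zero, Complex.exp_zero] at h1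
    simpa using h1.mul ((hu.tendsto_lap x₀ (h.re_pos hρ) hT).const_mul
      (mult β x₀ x (ρ * dir θ) * dir θ))

/-- Splits off the free heat flow. That part has no integrable bound uniform in τ along the ray, so
it is computed exactly before τ → 0. -/
theorem evolve_eq_sub (h : AdmissibleAngle β x₀ θ c) (v : H1) (x : ℝ) {τ : ℝ} (hτ : 0 < τ) :
    evolve β x₀ θ x τ (H1.rep v) =
      (∫ r, H1.rep v (x + √τ * r) * (√Real.pi / 2 * Real.exp (-(1 / 4) * r ^ 2))) -
      (∫ ρ in Set.Ioi (0 : ℝ), Complex.exp (((ρ : ℂ) * dir θ) ^ 2 * τ) *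
        (mult β x₀ x (ρ * dir θ) * dir θ * lap (H1.rep v) x₀ (ρ * dir θ))).im := by
  have hb : 0 < τ * -Real.cos (2 * θ) := mul_pos hτ h.neg_cos_pos
  have hG := integrableOn_rpow_mul_exp_neg_mul_sq hb (s := -(1 / 2)) (by norm_num)
  have hvm := (H1.continuous_rep v).aestronglyMeasurable (μ := volume)
  have i1 : IntegrableOn (fun ρ : ℝ => Complex.exp (((ρ : ℂ) * dir θ) ^ 2 * τ) * dir θ *
      lap (H1.rep v) x (ρ * dir θ)) (Set.Ioi 0) := by
    refine (hG.const_mul (2 * ‖v‖ * (1 / √(Real.cos θ)))).mono'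
      (((AdmissibleAngle.continuous_exp_sq θ τ).aestronglyMeasurable.mul_const _).mul
        (aestronglyMeasurable_lap hvm x θ)) ?_
    filter_upwards [ae_restrict_mem measurableSet_Ioi] with ρ hρ
    rw [norm_mul, norm_mul, norm_dir, mul_one, norm_exp_sq_mul_dir, ← neg_mul]
    calc _ ≤ Real.exp (-(τ * -Real.cos (2 * θ)) * ρ ^ 2) * _ :=
          mul_le_mul_of_nonneg_left (h.norm_lap_le_rpow v x hρ) (Real.exp_pos _).le
      _ = _ := by ring
  have i2 : IntegrableOn (fun ρ : ℝ => Complex.exp (((ρ : ℂ) * dir θ) ^ 2 * τ) *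
      (mult β x₀ x (ρ * dir θ) * dir θ * lap (H1.rep v) x₀ (ρ * dir θ))) (Set.Ioi 0) := by
    refine (i1.sub ((h.integrableOn_exp_mul_resPair v x hτ).mul_const (dir θ))).congr_fun
      (fun ρ _ => ?_) measurableSet_Ioi
    simp only [Pi.sub_apply, resPair]
    ring
  have e1 : (∫ ρ in Set.Ioi (0 : ℝ), Complex.exp (((ρ : ℂ) * dir θ) ^ 2 * τ) * dir θ *
      lap (H1.rep v) x (ρ * dir θ)).im =
      ∫ r, H1.rep v (x + √τ * r) * (√Real.pi / 2 * Real.exp (-(1 / 4) * r ^ 2)) := by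
    rw [h.im_integral_mul_lap v x
      ((AdmissibleAngle.continuous_exp_sq θ τ).aestronglyMeasurable.mul_const _),
      ← integral_rep_mul_gaussian v x hτ]
    · refine integral_congr_ae (Eventually.of_forall fun ξ => ?_)
      simp only
      rw [← im_rayInt_gaussian h.lt_angle h.angle_lt hτ (abs_nonneg (ξ - x)), rayInt]
      congr 2
      refine setIntegral_congr_fun measurableSet_Ioi fun ρ _ => ?_
      simp only [kern]
      ring
    · refine hG.congr_fun (fun ρ _ => ?_) measurableSet_Ioi
      simp only
      rw [norm_mul, norm_dir, mul_one, norm_exp_sq_mul_dir, neg_mul, mul_comm]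
  rw [← e1, ← Complex.sub_im, ← integral_sub i1 i2, evolve, rayInt]
  congr 1
  refine setIntegral_congr_fun measurableSet_Ioi fun ρ _ => ?_
  simp only [resPair]
  ring

/-- The limit of the conserved quantity at the final time. -/
theorem tendsto_evolve (hu : IsSolution β x₀ U₀ u) (h : AdmissibleAngle β x₀ θ c) (x : ℝ)
    {T : ℝ} (hT : 0 < T) :
    Tendsto (fun t => evolve β x₀ θ x (T - t) (H1.rep (u t))) (𝓝[<] T)
      (𝓝 (Real.pi * H1.rep (u T) x)) := by
  have h1 := (hu.tendsto_integral_gaussian x hT).sub (hu.tendsto_integral_mult h x hT)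
  rw [sub_zero] at h1
  refine h1.congr' ?_
  filter_upwards [self_mem_nhdsWithin] with t ht
  exact (evolve_eq_sub h (u t) x (by linarith [show t < T from ht])).symm

/-- Representation of the solution by a contour integral. -/
theorem pi_mul_rep_eq {u₀ : ℝ → ℝ} {hu₀ : Integrable u₀}
    (hu : IsSolution β x₀ (ofL1 u₀ hu₀) u) (h : AdmissibleAngle β x₀ θ c) (hx₀ : 0 ≤ x₀) (x : ℝ)
    {T : ℝ} (hT : 0 < T) :
    Real.pi * H1.rep (u T) x = evolve β x₀ θ x T u₀ := by
  -- The value at the midpoint T/2 links the one-sided limits at 0 and at T.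
  have hconst : ∀ t ∈ Set.Ioo 0 T, evolve β x₀ θ x (T - T / 2) (H1.rep (u (T / 2))) =
      evolve β x₀ θ x (T - t) (H1.rep (u t)) := by
    intro t ht
    rcases le_total (T / 2) t with hle | hle
    · exact hu.evolve_eq_evolve h hx₀ x (by linarith) hle ht.2
    · exact (hu.evolve_eq_evolve h hx₀ x ht.1 hle (by linarith)).symm
  have l0 := tendsto_nhds_unique (tendsto_const_nhds.congr'
    (mem_of_superset (Ioo_mem_nhdsGT hT) hconst)) (hu.tendsto_evolve_zero h x hT)
  have l1 := tendsto_nhds_unique (tendsto_const_nhds.congr'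
    (mem_of_superset (Ioo_mem_nhdsLT hT) hconst)) (hu.tendsto_evolve h x hT)
  rw [← l0, ← l1]

end IsSolution

/-! ### Decay -/

namespace AdmissibleAngle

variable {β x₀ θ c : ℝ}

/-- The L¹ norm bounds `lap` uniformly in z, since the kernel has modulus at most 1; the half-line
Gaussian integral supplies T^{-1/2}. -/
theorem abs_evolve_le (h : AdmissibleAngle β x₀ θ c) {u₀ : ℝ → ℝ} (hu₀ : Integrable u₀) (x : ℝ)
    {T : ℝ} (hT : 0 < T) :
    |evolve β x₀ θ x T u₀| ≤
      (1 + |β| / c) * (∫ ξ, |u₀ ξ|) * (√(Real.pi / -Real.cos (2 * θ)) / 2) * (1 / √T) := by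
  have hb : 0 < T * -Real.cos (2 * θ) := mul_pos hT h.neg_cos_pos
  refine (Complex.abs_im_le_norm _).trans ?_
  unfold rayInt
  refine (norm_integral_le_of_norm_le ((integrable_exp_neg_mul_sq hb).integrableOn.const_mul
    ((1 + |β| / c) * ∫ ξ, |u₀ ξ|)) ?_).trans (le_of_eq ?_)
  · filter_upwards [ae_restrict_mem measurableSet_Ioi] with ρ hρ
    rw [norm_mul, norm_dir, mul_one, norm_mul, norm_exp_sq_mul_dir, ← neg_mul, mul_comm]
    exact mul_le_mul_of_nonneg_right (h.norm_resPair_le hρ fun a =>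
      norm_lap_le_integral hu₀ a (h.re_pos hρ).le) (Real.exp_pos _).le
  · rw [integral_const_mul, integral_gaussian_Ioi, mul_comm T, ← div_div,
      Real.sqrt_div (div_nonneg Real.pi_pos.le h.neg_cos_pos.le)]
    ring

theorem integral_mul_exp_neg_mul_sq {b : ℝ} (hb : 0 < b) :
    ∫ r in Set.Ioi (0 : ℝ), r * Real.exp (-b * r ^ 2) = (2 * b)⁻¹ := by
  have h := integral_mul_cexp_neg_mul_sq (b := (b : ℂ)) (by simpa using hb)
  rw [← Complex.ofReal_inj, ← integral_complex_ofReal]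
  push_cast
  exact h

/-- By `resPair_self` the Gaussian now carries a factor ρ, and ∫ ρ e^{-bTρ²} dρ = 1/(2bT). -/
theorem abs_evolve_self_le (h : AdmissibleAngle β x₀ θ c) (hx₀ : 0 ≤ x₀) {u₀ : ℝ → ℝ}
    (hu₀ : Integrable u₀) {T : ℝ} (hT : 0 < T) :
    |evolve β x₀ θ x₀ T u₀| ≤
      2 * (∫ ξ, |u₀ ξ|) / c * (2 * -Real.cos (2 * θ))⁻¹ * (1 / T) := by
  have hb : 0 < T * -Real.cos (2 * θ) := mul_pos hT h.neg_cos_pos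
  refine (Complex.abs_im_le_norm _).trans ?_
  unfold rayInt
  refine (norm_integral_le_of_norm_le ((integrable_mul_exp_neg_mul_sq hb).integrableOn.const_mul
    (2 * (∫ ξ, |u₀ ξ|) / c)) ?_).trans (le_of_eq ?_)
  · filter_upwards [ae_restrict_mem measurableSet_Ioi] with ρ hρ
    have hρ0 : (0 : ℝ) < ρ := hρ
    rw [norm_mul, norm_dir, mul_one, norm_mul, norm_exp_sq_mul_dir, ← neg_mul,
      resPair_self hx₀ _ (h.charFn_ne_zero hρ0.le), norm_div, norm_mul, norm_mul,
      norm_mul_dir hρ0.le, Complex.norm_two]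
    have h1 := norm_lap_le_integral hu₀ x₀ (h.re_pos hρ0).le
    have h2 : c ≤ ‖charFn β x₀ (ρ * dir θ)‖ :=
      le_trans (by nlinarith [h.pos]) (h.le_norm_ray hρ0.le)
    have h3 : 0 ≤ ∫ ξ, |u₀ ξ| := integral_nonneg fun _ => abs_nonneg _
    have h4 := h.pos
    calc _ ≤ Real.exp (-(T * -Real.cos (2 * θ)) * ρ ^ 2) * (2 * ρ * (∫ ξ, |u₀ ξ|) / c) := by
          gcongr
      _ = _ := by ring
  · rw [integral_const_mul, integral_mul_exp_neg_mul_sq hb]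
    have := h.neg_cos_pos.ne'
    field_simp

end AdmissibleAngle

end ThermostatLine

end

/-! ### The two decay rates -/

open ThermostatLine in
theorem proposition2p5 (x₀ : ℝ) (hx₀ : 0 < x₀) (β : ℝ) (hβ : 0 < β) (hβ₁ : β < betaOne x₀)
    (u₀ : ℝ → ℝ) (hu₀ : Integrable u₀)
    (u : ℝ → H1) (hu : IsSolution β x₀ (ofL1 u₀ hu₀) u) :
    ((fun t : ℝ => H1.rep (u t) x₀) =O[atTop] fun t : ℝ => 1 / t) ∧
      ∀ x : ℝ, x ≠ x₀ → (fun t : ℝ => H1.rep (u t) x) =O[atTop] fun t : ℝ => 1 / √t := by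
  obtain ⟨θ, c, h⟩ := exists_admissibleAngle hβ hx₀ hβ₁
  have hrep : ∀ x T : ℝ, 0 < T → |H1.rep (u T) x| ≤ |evolve β x₀ θ x T u₀| := by
    intro x T hT
    rw [← hu.pi_mul_rep_eq h hx₀.le x hT, abs_mul, abs_of_pos Real.pi_pos]
    -- The factor π ≥ 1 in the representation formula is simply dropped.
    exact le_mul_of_one_le_left (abs_nonneg _) (by linarith [Real.pi_gt_three])
  constructor
  · refine IsBigO.of_bound (2 * (∫ ξ, |u₀ ξ|) / c * (2 * -Real.cos (2 * θ))⁻¹) ?_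
    filter_upwards [eventually_gt_atTop 0] with T hT
    rw [Real.norm_eq_abs, Real.norm_of_nonneg (by positivity : 0 ≤ 1 / T)]
    exact (hrep x₀ T hT).trans (h.abs_evolve_self_le hx₀.le hu₀ hT)
  · intro x _
    refine IsBigO.of_bound
      ((1 + |β| / c) * (∫ ξ, |u₀ ξ|) * (√(Real.pi / -Real.cos (2 * θ)) / 2)) ?_
    filter_upwards [eventually_gt_atTop 0] with T hT
    rw [Real.norm_eq_abs, Real.norm_of_nonneg (by positivity : 0 ≤ 1 / √T)]
    exact (hrep x T hT).trans (h.abs_evolve_le hu₀ x hT)
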